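/- View $SU(2)$ as the group of unit quaternions and $S^2$ as the sphere $S(\mathrm{Im}\,\mathbb H)$ of purely imaginary unit quaternions. Let $n\ge 1$, $p_1,\dots,p_n\in\mathbb Z$, and let $K=P(p_1,\dots,p_n)$ be the pretzel knot or link whose standard diagram has $n$ columns, cyclically ordered, the $i$-th column being a vertical twist of two strands with $|p_i|$ crossings, left-handed for $p_i>0$ and right-handed for $p_i<0$; the right strand of column $i$ is joined at the top and at the bottom to the left strand of column $i+1$ (indices mod $n$). Let $G(K)$ be the link group, given by the Wirtinger presentation of this diagram, and let $s_i\in G(K)$ be the meridian of the top left strand of column $i$, directed downwards (so $s_{i+1}^{-1}$ is the downward meridian of the top right strand of column $i$). Let $R(K;\mathbf i)$ be the set of homomorphisms $\rho:G(K)\to SU(2)$ that map every meridian to a conjugate of $\mathbf i$, with the topology of pointwise convergence. Consider one of two cases: in the case $+1$ put $c=+1$, $d=0$, $E=\{0,\pi\}$; in the case $-1$ put $c=-1$, $d=1$, $E=\{0\}$. Let $\mathscr R_c$ be the space of conjugacy classes, with the quotient topology, of those $\rho\in R(K;\mathbf i)$ with $$\rho((s_1s_2)^{p_1})=\rho((s_2s_3)^{p_2})=\dots=\rho((s_ns_1)^{p_n})=c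 .$$ Let $\mathscr P_c$ be the set of ordered $n$-tuples $(\mathbf z_1,\dots,\mathbf z_n)$ of points of $S^2$ (repetitions allowed) such that, with $\alpha_{i,i+1}\in[0,\pi]$ the spherical distance from $\mathbf z_i$ to $\mathbf z_{i+1}$ and $n+1=1$ understood, 1. $p_i\,\alpha_{i,i+1}\equiv (p_i+d)\,\pi \pmod{2\pi}$ for $i=1,\dots,n$; 2. $\mathbf z_1=\mathbf j$ and $\mathbf z_{m+1}=\mathbf z_m\, e^{\mathbf i\,\alpha_{m,m+1}}$ for $m=1,\dots,l$, where $l$ is the smallest index with $\alpha_{l,l+1}\notin E$ if there is one, and $l=n$ if not. Then: (a) There is a bijection $\mathscr R_c\to\mathscr P_c$ under which $[\rho]$ corresponds to $(\mathbf z_1,\dots,\mathbf z_n)$ if and only if some conjugate $\rho'$ of $\rho$ satisfies $\rho'(s_i)=\mathbf z_i$ for all $i$. (b) $\rho$ is non-abelian if and only if some $\alpha_{i,i+1}$ is not in $E$. In the case $-1$ no $\alpha_{i,i+1}$ equals $\pi$. (c) Reflection in the plane $\langle\mathbf j,\mathbf k\rangle$, applied to all $\mathbf z_i$, maps $\mathscr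 P_c$ to itself and induces through (a) a continuous involution $\tau$ of $\mathscr R_c$. (d) Suppose that $K$ is a knot. Then $\rho$ is binary dihedral, that is, has image in a subgroup conjugate to $Pin(2)=S^1\sqcup \mathbf j S^1$ with $S^1=\{e^{\mathbf i t}\}$, if and only if all the points $\mathbf z_i$ corresponding to $[\rho]$ lie on the great circle in the plane $\langle\mathbf j,\mathbf k\rangle$. The fixed points of $\tau$ are exactly the binary dihedral classes. In particular, $\tau$ pairs each non-abelian class that is not binary dihedral with a different class of the same kind. (e) For an arbitrary pretzel link $K$, the first two statements in (d) hold when "binary dihedral" is replaced by the condition that for some $g\in SU(2)$ all meridians are mapped into $g\,\mathbf j S^1 g^{-1}$; every such representation is binary dihedral. -/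

import Mathlib

open scoped Quaternion Real

noncomputable section

/-- `SU(2)`, viewed as the group of unit quaternions. -/
abbrev SU2 : Type := Metric.sphere (0 : ℍ[ℝ]) 1

/-- The quaternion unit `i`. -/
def qI : ℍ[ℝ] := ⟨0, 1, 0, 0⟩

/-- The quaternion unit `j`. -/
def qJ : ℍ[ℝ] := ⟨0, 0, 1, 0⟩

/-- The quaternion unit `i` as an element of `SU(2)`. -/
def unitI : SU2 := ⟨qI, by
  have h : ‖qI‖ * ‖qI‖ = 1 := by
    rw [← Quaternion.normSq_eq_norm_mul_self, Quaternion.normSq_def']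
    simp [qI]
  rw [mem_sphere_zero_iff_norm]
  nlinarith [norm_nonneg qI]⟩

/-- `j · S¹`: the unit quaternions in the plane spanned by `j` and `k`. -/
def jCircle : Set SU2 := {q | (q : ℍ[ℝ]).re = 0 ∧ (q : ℍ[ℝ]).imI = 0}

/-- `Pin(2) = S¹ ⊔ j · S¹`, where `S¹` is the circle of unit complex numbers. -/
def Pin2 : Subgroup SU2 where
  carrier := {q | (q : ℍ[ℝ]).imJ = 0 ∧ (q : ℍ[ℝ]).imK = 0} ∪ jCircle
  one_mem' := by simp
  mul_mem' := by
    rintro a b (⟨h1, h2⟩ | ⟨h1, h2⟩) (⟨h3, h4⟩ | ⟨h3, h4⟩) <;>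
      simp [jCircle, h1, h2, h3, h4]
  inv_mem' := by
    rintro a (⟨h1, h2⟩ | ⟨h1, h2⟩) <;> simp [jCircle, Quaternion.inv_def, h1, h2]

/-! ### The standard diagram of the pretzel link `P(p₁, …, pₙ)`

The diagram has `n` columns, cyclically ordered and indexed by `Fin n`; column `i` is a vertical
two-strand twist with `|p i|` crossings, left-handed if `p i > 0` and right-handed if `p i < 0`.
The crossings cut the two strands of column `i` into the edges at levels `0, …, |p i|`
(from top to bottom). At the top and at the bottom the right strand of column `i` is joined by an
arc to the left strand of column `i + 1` (with the last column followed by the first). -/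

variable {n : ℕ}

/-- The edges of the diagram. -/
structure PretzelEdge (p : Fin n → ℤ) where
  col : Fin n
  level : Fin ((p col).natAbs + 1)
  right : Bool

/-- The left edge of column `i` at level `k`. -/
def edgeL (p : Fin n → ℤ) (i : Fin n) (k : Fin ((p i).natAbs + 1)) : PretzelEdge p := ⟨i, k, false⟩

/-- The right edge of column `i` at level `k`. -/
def edgeR (p : Fin n → ℤ) (i : Fin n) (k : Fin ((p i).natAbs + 1)) : PretzelEdge p := ⟨i, k, true⟩

/-- The Wirtinger relators of the diagram. The generator of an edge is the meridian of that edge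
when the edge is directed downwards, with base point in front of the diagram. Hence two edges that
are joined by an arc at the top or at the bottom have inverse meridians; at a crossing the meridian
of the over-strand does not change, and the meridian of the under-strand is conjugated by the
meridian of the over-strand. In a left-handed column the over-strand runs from the upper left to the
lower right, in a right-handed column from the upper right to the lower left. -/
inductive WirtingerRelator [NeZero n] (p : Fin n → ℤ) : FreeGroup (PretzelEdge p) → Prop
  | top (i : Fin n) :
      WirtingerRelator p (.of (edgeR p i 0) * .of (edgeL p (i + 1) 0))
  | bottom (i : Fin n) :
      WirtingerRelator p (.of (edgeR p i (Fin.last _)) * .of (edgeL p (i + 1) (Fin.last _)))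
  | posOver (i : Fin n) (h : 0 < p i) (k : Fin (p i).natAbs) :
      WirtingerRelator p ((.of (edgeR p i k.succ))⁻¹ * .of (edgeL p i k.castSucc))
  | posUnder (i : Fin n) (h : 0 < p i) (k : Fin (p i).natAbs) :
      WirtingerRelator p ((.of (edgeL p i k.succ))⁻¹ *
        ((.of (edgeL p i k.castSucc))⁻¹ * .of (edgeR p i k.castSucc) * .of (edgeL p i k.castSucc)))
  | negOver (i : Fin n) (h : p i < 0) (k : Fin (p i).natAbs) :
      WirtingerRelator p ((.of (edgeL p i k.succ))⁻¹ * .of (edgeR p i k.castSucc))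
  | negUnder (i : Fin n) (h : p i < 0) (k : Fin (p i).natAbs) :
      WirtingerRelator p ((.of (edgeR p i k.succ))⁻¹ *
        (.of (edgeR p i k.castSucc) * .of (edgeL p i k.castSucc) * (.of (edgeR p i k.castSucc))⁻¹))

/-- The group `G(K)` of the pretzel link `K = P(p₁, …, pₙ)`, given by the Wirtinger presentation of
its standard diagram. -/
abbrev PretzelGroup [NeZero n] (p : Fin n → ℤ) : Type :=
  PresentedGroup {r | WirtingerRelator p r}

/-- The meridian of an edge of the diagram. -/
def meridian [NeZero n] (p : Fin n → ℤ) (e : PretzelEdge p) : PretzelGroup p :=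
  PresentedGroup.of e

/-- The meridian `s_i`: that of the top left edge of column `i`. The right strand of the preceding
column has meridian `s_i⁻¹` at the top. -/
def sGen [NeZero n] (p : Fin n → ℤ) (i : Fin n) : PretzelGroup p :=
  meridian p (edgeL p i 0)

/-- Two edges follow each other along the link: they are joined by an arc at the top or at the
bottom, or are the two halves of a strand that passes through a crossing. -/
inductive StrandAdj [NeZero n] (p : Fin n → ℤ) : PretzelEdge p → PretzelEdge p → Prop
  | top (i : Fin n) : StrandAdj p (edgeR p i 0) (edgeL p (i + 1) 0)
  | bottom (i : Fin n) : StrandAdj p (edgeR p i (Fin.last _)) (edgeL p (i + 1) (Fin.last _))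
  | leftRight (i : Fin n) (k : Fin (p i).natAbs) :
      StrandAdj p (edgeL p i k.castSucc) (edgeR p i k.succ)
  | rightLeft (i : Fin n) (k : Fin (p i).natAbs) :
      StrandAdj p (edgeR p i k.castSucc) (edgeL p i k.succ)

/-- The pretzel link is a knot: it has only one component. -/
def IsPretzelKnot [NeZero n] (p : Fin n → ℤ) : Prop :=
  ∀ e e' : PretzelEdge p, Relation.EqvGen (StrandAdj p) e e'

/-! ### Representations -/

/-- The representations `ρ ∈ R(K; i)`, that is, those that map every meridian to a conjugate of `i`,
with `ρ((s_i s_{i+1})^{p_i}) = c` for all `i`. -/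
def RepSpace [NeZero n] (p : Fin n → ℤ) (c : SU2) : Type :=
  {ρ : PretzelGroup p →* SU2 //
    (∀ e : PretzelEdge p, IsConj (ρ (meridian p e)) unitI) ∧
    ∀ i, ρ ((sGen p i * sGen p (i + 1)) ^ (p i)) = c}

/-- The topology of pointwise convergence, which is the compact-open topology for the discrete
topology on `G(K)`. -/
instance [NeZero n] (p : Fin n → ℤ) (c : SU2) : TopologicalSpace (RepSpace p c) :=
  TopologicalSpace.induced (fun ρ (x : PretzelGroup p) => ρ.1 x) inferInstance

/-- Conjugacy of representations. -/
instance repSetoid [NeZero n] (p : Fin n → ℤ) (c : SU2) : Setoid (RepSpace p c) where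
  r ρ ρ' := ∃ g : SU2, ∀ x, ρ'.1 x = g * ρ.1 x * g⁻¹
  iseqv :=
    { refl := fun ρ => ⟨1, by simp⟩
      symm := by
        rintro ρ ρ' ⟨g, hg⟩
        exact ⟨g⁻¹, fun x => by rw [hg]; group⟩
      trans := by
        rintro ρ ρ' ρ'' ⟨g, hg⟩ ⟨h, hh⟩
        exact ⟨h * g, fun x => by rw [hh, hg]; group⟩ }

/-- The space of conjugacy classes, with the quotient topology. -/
abbrev RepClass [NeZero n] (p : Fin n → ℤ) (c : SU2) : Type := Quotient (repSetoid p c)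

/-- `ρ` has commutative image. -/
def IsAbelianRep {G : Type*} [Group G] (ρ : G →* SU2) : Prop := ∀ x y, ρ x * ρ y = ρ y * ρ x

/-- `ρ` is binary dihedral: it factors through a subgroup that is conjugate to `Pin(2)`. -/
def IsBinaryDihedral {G : Type*} [Group G] (ρ : G →* SU2) : Prop :=
  ∃ g : SU2, ρ.range ≤ Pin2.map (MulAut.conj g).toMonoidHom

/-- `ρ` maps all meridians into the component `g (j · S¹) g⁻¹` of one conjugate `g Pin(2) g⁻¹`. -/
def IsMeridionallyDihedral [NeZero n] {p : Fin n → ℤ} (ρ : PretzelGroup p →* SU2) : Prop :=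
  ∃ g : SU2, ∀ e : PretzelEdge p, ∃ q ∈ jCircle, ρ (meridian p e) = g * q * g⁻¹

/-! ### Polygons on `S² = S(Im ℍ)` -/

/-- The side length `α_{i,i+1} ∈ [0, π]`: the spherical distance from `z_i` to `z_{i+1}`. -/
def sideLength [NeZero n] (z : Fin n → SU2) (i : Fin n) : ℝ :=
  InnerProductGeometry.angle (z i : ℍ[ℝ]) (z (i + 1) : ℍ[ℝ])

/-- The conjugacy class fixing condition: `z₁ = j`, and `z_{m+1} = z_m e^{i α_{m,m+1}}` for
`m ≤ l`, where `l` is the first index with `α_{l,l+1} ∉ E`, or the last index if there is none;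
`m ≤ l` says that `α_{t,t+1} ∈ E` for all `t < m`. -/
def ConjFixing [NeZero n] (E : Set ℝ) (z : Fin n → SU2) : Prop :=
  (z 0 : ℍ[ℝ]) = qJ ∧
  ∀ m : Fin n, (∀ t : Fin n, t < m → sideLength z t ∈ E) →
    (z (m + 1) : ℍ[ℝ]) = (z m : ℍ[ℝ]) * NormedSpace.exp (sideLength z m • qI)

/-- Normalized `n`-gons on `S(Im ℍ)` with `p_i α_{i,i+1} ≡ (p_i + d) π` modulo `2π`. -/
def NormalizedPolygon [NeZero n] (p : Fin n → ℤ) (d : ℤ) (E : Set ℝ) : Type :=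
  {z : Fin n → SU2 //
    (∀ i, (z i : ℍ[ℝ]).re = 0) ∧
    (∀ i, (p i : ℝ) * sideLength z i ≡ ((p i + d : ℤ) : ℝ) * π [PMOD (2 * π)]) ∧
    ConjFixing E z}

/-- The reflection in the plane spanned by `j` and `k`. -/
def reflJK (q : ℍ[ℝ]) : ℍ[ℝ] := ⟨q.re, -q.imI, q.imJ, q.imK⟩

end

noncomputable section

-- Everything reduces to the values `z_i = ρ(s_i)`, which are imaginary unit quaternions. With `u =
-- z_i z_{i+1}` one has `z_i u z_i⁻¹ = u⁻¹`, so in column `i` the crossing relations act as in a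
-- dihedral group: going down the column, the meridians take the values `u^m z_i` with `m` moving by
-- one per level (`meridian_eq_edgeValue`). The relations at the top and at the crossings then hold
-- for arbitrary `z`, and those at the bottom hold once all `(z_i z_{i+1})^{p_i}` equal the same
-- sign `c` (`lift_edgeValue_relator`). So representations are exactly the tuples of imaginary units
-- satisfying the power condition. Since `Re (z_i z_{i+1}) = cos (π - α)`, that condition is the
-- congruence on the side lengths (`IsSignCase.zpow_eq_iff`).
--
-- Conjugation acts on tuples by rotations of the sphere. Sides in `E` have length `0` or `π`, so
-- once `z_1 = j` all vertices up to the first other side are `±j`. A rotation about `j` puts the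
-- far end of that side in the prescribed position (`exists_conjFixing`), and only central elements
-- preserve the result (`conjFixing_unique`). If all sides lie in `E`, the tuple consists of `±j`
-- and nothing is left to choose; this is the abelian case.
--
-- The involution is multiplication of `ρ` by the character sending every meridian to `-1`, which
-- makes continuity evident. It is the reflection because `q ↦ i(-q)i⁻¹` is the reflection in the
-- plane of `j` and `k` on imaginary quaternions (`twist_toRep`). Its fixed classes are thus the
-- polygons in that plane. For a knot, the meridians of a representation into `Pin2` lie all in `j
-- S¹` or all in `S¹`; in the second case they are `±i`, and conjugation by `j` shows that the class
-- is fixed as well.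

local instance : Group SU2 := Metric.unitSphere.instGroup
local instance : Mul SU2 := Metric.unitSphere.instGroup.toMul
local instance : HasDistribNeg SU2 := Metric.sphere.instHasDistribNeg

/-- The quaternion with given coordinates. -/
def mkQ (a b c d : ℝ) : ℍ[ℝ] := ⟨a, b, c, d⟩

section coords

variable (a b c d : ℝ) (q : ℍ[ℝ])

@[simp] theorem mkQ_re : (mkQ a b c d).re = a := rfl
@[simp] theorem mkQ_imI : (mkQ a b c d).imI = b := rfl
@[simp] theorem mkQ_imJ : (mkQ a b c d).imJ = c := rfl
@[simp] theorem mkQ_imK : (mkQ a b c d).imK = d := rfl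
@[simp] theorem qI_re : qI.re = 0 := rfl
@[simp] theorem qI_imI : qI.imI = 1 := rfl
@[simp] theorem qI_imJ : qI.imJ = 0 := rfl
@[simp] theorem qI_imK : qI.imK = 0 := rfl
@[simp] theorem qJ_re : qJ.re = 0 := rfl
@[simp] theorem qJ_imI : qJ.imI = 0 := rfl
@[simp] theorem qJ_imJ : qJ.imJ = 1 := rfl
@[simp] theorem qJ_imK : qJ.imK = 0 := rfl
@[simp] theorem reflJK_re : (reflJK q).re = q.re := rfl
@[simp] theorem reflJK_imI : (reflJK q).imI = -q.imI := rfl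
@[simp] theorem reflJK_imJ : (reflJK q).imJ = q.imJ := rfl
@[simp] theorem reflJK_imK : (reflJK q).imK = q.imK := rfl

end coords

namespace SU2

/-! ### Coordinates of unit quaternions -/

theorem sq_sum (q : SU2) : (q : ℍ[ℝ]).re ^ 2 + (q : ℍ[ℝ]).imI ^ 2 + (q : ℍ[ℝ]).imJ ^ 2 +
    (q : ℍ[ℝ]).imK ^ 2 = 1 := by
  rw [← Quaternion.normSq_def', Quaternion.normSq_eq_norm_mul_self, mem_sphere_zero_iff_norm.1 q.2,
    one_mul]

/-- A unit quaternion given by its coordinates. -/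
def ofCoords (a b c d : ℝ) (h : a ^ 2 + b ^ 2 + c ^ 2 + d ^ 2 = 1) : SU2 :=
  ⟨mkQ a b c d, by
    have h' : ‖(mkQ a b c d)‖ * ‖(mkQ a b c d)‖ = 1 := by
      rw [← Quaternion.normSq_eq_norm_mul_self, Quaternion.normSq_def']
      exact h
    rw [mem_sphere_zero_iff_norm]
    nlinarith [norm_nonneg (mkQ a b c d)]⟩

theorem ext_coords {a b : SU2} (h0 : (a : ℍ[ℝ]).re = (b : ℍ[ℝ]).re)
    (h1 : (a : ℍ[ℝ]).imI = (b : ℍ[ℝ]).imI) (h2 : (a : ℍ[ℝ]).imJ = (b : ℍ[ℝ]).imJ)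
    (h3 : (a : ℍ[ℝ]).imK = (b : ℍ[ℝ]).imK) : a = b :=
  Subtype.ext (QuaternionAlgebra.ext h0 h1 h2 h3)

theorem coe_mul (a b : SU2) : ((a * b : SU2) : ℍ[ℝ]) = a * b := rfl

theorem coe_one : ((1 : SU2) : ℍ[ℝ]) = 1 := rfl

theorem coe_neg (a : SU2) : ((-a : SU2) : ℍ[ℝ]) = -a := rfl

theorem coe_inv (a : SU2) : ((a⁻¹ : SU2) : ℍ[ℝ]) = star (a : ℍ[ℝ]) := by
  rw [Metric.unitSphere.coe_inv, Quaternion.inv_def, Quaternion.normSq_eq_norm_mul_self,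
    mem_sphere_zero_iff_norm.1 a.2]
  simp

theorem one_ne_neg_one : (1 : SU2) ≠ -1 := by
  intro h
  have := congrArg (fun q : SU2 => (q : ℍ[ℝ]).re) h
  simp only [coe_neg, coe_one] at this
  norm_num at this

theorem eq_one_iff_re (q : SU2) : q = 1 ↔ (q : ℍ[ℝ]).re = 1 := by
  refine ⟨fun h => by simp [h], fun h => ?_⟩
  have := q.sq_sum
  rw [h] at this
  apply ext_coords <;> simp [h] <;> nlinarith [sq_nonneg (q : ℍ[ℝ]).imI,
    sq_nonneg (q : ℍ[ℝ]).imJ, sq_nonneg (q : ℍ[ℝ]).imK]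

theorem eq_neg_one_iff_re (q : SU2) : q = -1 ↔ (q : ℍ[ℝ]).re = -1 := by
  rw [← neg_eq_iff_eq_neg, eq_one_iff_re, coe_neg, Quaternion.re_neg, neg_eq_iff_eq_neg]

/-- The unit quaternion `j`. -/
def unitJ : SU2 := ofCoords 0 0 1 0 (by norm_num)

theorem unitJ_coe : (unitJ : ℍ[ℝ]) = qJ := rfl

theorem unitI_coe : (unitI : ℍ[ℝ]) = qI := rfl

/-! ### Purely imaginary unit quaternions -/

theorem re_eq_zero_iff_inv {q : SU2} : (q : ℍ[ℝ]).re = 0 ↔ q⁻¹ = -q := by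
  constructor
  · intro h
    apply Subtype.ext
    rw [coe_inv, coe_neg]
    ext <;> simp [h]
  · intro h
    have := congrArg (fun q : SU2 => (q : ℍ[ℝ]).re) h
    simp only [coe_inv, coe_neg, Quaternion.re_star, Quaternion.re_neg] at this
    linarith

theorem mul_self_of_re_eq_zero {a : SU2} (ha : (a : ℍ[ℝ]).re = 0) : a * a = -1 := by
  have := re_eq_zero_iff_inv.1 ha
  rwa [inv_eq_iff_mul_eq_one, mul_neg, neg_eq_iff_eq_neg] at this

theorem re_conj (g q : SU2) : ((g * q * g⁻¹ : SU2) : ℍ[ℝ]).re = (q : ℍ[ℝ]).re := by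
  have hg := g.sq_sum
  simp only [coe_mul, coe_inv, Quaternion.re_mul, Quaternion.imI_mul, Quaternion.imJ_mul,
    Quaternion.imK_mul, Quaternion.re_star, Quaternion.imI_star, Quaternion.imJ_star,
    Quaternion.imK_star]
  linear_combination (q : ℍ[ℝ]).re * hg

theorem exists_normalize (x : ℍ[ℝ]) (hx : x ≠ 0) : ∃ (g : SU2) (r : ℝ), (g : ℍ[ℝ]) = r • x :=
  ⟨⟨‖x‖⁻¹ • x, by
    rw [mem_sphere_zero_iff_norm, norm_smul, norm_inv, norm_norm,
      inv_mul_cancel₀ (norm_ne_zero_iff.2 hx)]⟩, ‖x‖⁻¹, rfl⟩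

theorem exists_conj_of_intertwine {a b : SU2} {x : ℍ[ℝ]} (hx : x ≠ 0) (h : x * a = b * x) :
    ∃ (g : SU2) (r : ℝ), (g : ℍ[ℝ]) = r • x ∧ g * a * g⁻¹ = b := by
  obtain ⟨g, r, hg⟩ := exists_normalize x hx
  refine ⟨g, r, hg, ?_⟩
  rw [mul_inv_eq_iff_eq_mul]
  apply Subtype.ext
  rw [coe_mul, coe_mul, hg, smul_mul_assoc, h, mul_smul_comm]

theorem eq_of_one_add_mul {a b : SU2} (hb : (b : ℍ[ℝ]).re = 0)
    (h : (1 : ℍ[ℝ]) - b * a = 0) : a = -b := by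
  have h1 : b * a = 1 := Subtype.ext (by rw [coe_mul, coe_one]; exact (sub_eq_zero.1 h).symm)
  rw [← re_eq_zero_iff_inv.1 hb]
  exact (inv_eq_of_mul_eq_one_right h1).symm

/-- Two purely imaginary unit quaternions with the same `j`-coordinate differ by a rotation
about `j`. -/
theorem exists_conj_of_imJ_eq {a b : SU2} (ha : (a : ℍ[ℝ]).re = 0) (hb : (b : ℍ[ℝ]).re = 0)
    (h : (a : ℍ[ℝ]).imJ = (b : ℍ[ℝ]).imJ) :
    ∃ g : SU2, g * unitJ * g⁻¹ = unitJ ∧ g * a * g⁻¹ = b := by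
  have hn := a.sq_sum.trans b.sq_sum.symm
  rw [ha, hb, h] at hn
  suffices ∃ x y : ℝ, mkQ x 0 y 0 ≠ 0 ∧
      mkQ x 0 y 0 * a = b * mkQ x 0 y 0 by
    obtain ⟨x, y, h0, hxy⟩ := this
    obtain ⟨g, r, hg, hgab⟩ := exists_conj_of_intertwine h0 hxy
    refine ⟨g, ?_, hgab⟩
    rw [mul_inv_eq_iff_eq_mul]
    apply Subtype.ext
    rw [coe_mul, coe_mul, hg, unitJ_coe]
    ext <;> simp 
  -- Lifts of rotations about `j` are `x + y j`, and intertwining `a` with `b` is a linear system in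
  -- `x`, `y`. Both nonzero choices below solve it; if both sums vanish, `b` is the half-turn of `a`
  -- about `j`, and `j` itself works.
  by_cases h0 : (a : ℍ[ℝ]).imI + (b : ℍ[ℝ]).imI = 0 ∧ (a : ℍ[ℝ]).imK + (b : ℍ[ℝ]).imK = 0
  · refine ⟨0, 1, fun h => ?_, ?_⟩
    · simpa using congrArg (fun q : ℍ[ℝ] => q.imJ) h
    · ext <;> simp [ha, hb, h] <;> linarith [h0.1, h0.2]
  · by_cases h1 : (a : ℍ[ℝ]).imI + (b : ℍ[ℝ]).imI = 0
    · have h2 : (a : ℍ[ℝ]).imK + (b : ℍ[ℝ]).imK ≠ 0 := fun h2 => h0 ⟨h1, h2⟩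
      refine ⟨(a : ℍ[ℝ]).imK + (b : ℍ[ℝ]).imK, (b : ℍ[ℝ]).imI - (a : ℍ[ℝ]).imI, fun h => ?_, ?_⟩
      · exact h2 (by simpa using congrArg (fun q : ℍ[ℝ] => q.re) h)
      · ext <;> simp [ha, hb, h] <;> linarith
    · refine ⟨(a : ℍ[ℝ]).imI + (b : ℍ[ℝ]).imI, (a : ℍ[ℝ]).imK - (b : ℍ[ℝ]).imK, fun h => ?_, ?_⟩
      · exact h1 (by simpa using congrArg (fun q : ℍ[ℝ] => q.re) h)
      · ext <;> simp [ha, hb, h] <;> linarith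

/-- All purely imaginary unit quaternions are conjugate. -/
theorem isConj_of_re_eq_zero {a b : SU2} (ha : (a : ℍ[ℝ]).re = 0) (hb : (b : ℍ[ℝ]).re = 0) :
    IsConj a b := by
  rw [isConj_iff]
  by_cases h : (1 : ℍ[ℝ]) - b * a = 0
  · have hab := eq_of_one_add_mul hb h
    obtain ⟨x, hx, hxa⟩ : ∃ x : ℍ[ℝ], x ≠ 0 ∧ x * a = b * x := by
      -- Here `a = -b`, so any imaginary vector orthogonal to `b` anticommutes with it and serves:
      -- `b × k`, or `i` when `b = ±k`.
      by_cases hI : (b : ℍ[ℝ]).imI = 0 ∧ (b : ℍ[ℝ]).imJ = 0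
      · refine ⟨qI, fun h => ?_, ?_⟩
        · simpa using congrArg (fun q : ℍ[ℝ] => q.imI) h
        · rw [hab, coe_neg]
          ext <;> simp [hI.1, hI.2, hb]
      · refine ⟨mkQ 0 (b : ℍ[ℝ]).imJ (-(b : ℍ[ℝ]).imI) 0, fun h => hI ⟨?_, ?_⟩, ?_⟩
        · simpa using congrArg (fun q : ℍ[ℝ] => q.imJ) h
        · simpa using congrArg (fun q : ℍ[ℝ] => q.imI) h
        · rw [hab, coe_neg]
          ext <;> simp [hb] <;> ring
    obtain ⟨g, -, -, hg⟩ := exists_conj_of_intertwine hx hxa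
    exact ⟨g, hg⟩
  · have ha' : (a : ℍ[ℝ]) * a = -1 := congrArg Subtype.val (mul_self_of_re_eq_zero ha)
    have hb' : (b : ℍ[ℝ]) * b = -1 := congrArg Subtype.val (mul_self_of_re_eq_zero hb)
    -- `1 - b a` intertwines: as `a² = b² = -1`, both products equal `a + b`.
    obtain ⟨g, -, -, hg⟩ := exists_conj_of_intertwine (a := a) (b := b) h (by
      rw [sub_mul, mul_sub, mul_assoc, ha', ← mul_assoc (b : ℍ[ℝ]) b, hb']
      simp [add_comm])
    exact ⟨g, hg⟩

theorem isConj_unitI_iff {q : SU2} : IsConj q unitI ↔ (q : ℍ[ℝ]).re = 0 := by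
  refine ⟨fun h => ?_, fun h => isConj_of_re_eq_zero h rfl⟩
  obtain ⟨g, hg⟩ := isConj_iff.1 h
  rw [← re_conj g, hg]
  rfl

/-! ### Powers and angles -/

theorem re_pow_of_re_eq_cos {q : SU2} {θ : ℝ} (h : (q : ℍ[ℝ]).re = Real.cos θ) (m : ℕ) :
    ((q ^ m : SU2) : ℍ[ℝ]).re = Real.cos (m * θ) := by
  induction m using Nat.twoStepInduction with
  | zero => simp
  | one => simpa using h
  | more m h1 h2 =>
    -- Chebyshev recursion, from `q² = 2 Re(q) q - 1` for unit `q`.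
    have hrec : ((q ^ (m + 2) : SU2) : ℍ[ℝ]).re =
        2 * (q : ℍ[ℝ]).re * ((q ^ (m + 1) : SU2) : ℍ[ℝ]).re - ((q ^ m : SU2) : ℍ[ℝ]).re := by
      rw [pow_succ q (m + 1), pow_succ q m]
      simp only [coe_mul, Quaternion.re_mul, Quaternion.imI_mul, Quaternion.imJ_mul,
        Quaternion.imK_mul]
      linear_combination -((q ^ m : SU2) : ℍ[ℝ]).re * q.sq_sum
    rw [hrec, h1, h2, h]
    have e1 : ((m + 2 : ℕ) : ℝ) * θ = ((m + 1 : ℕ) : ℝ) * θ + θ := by push_cast; ring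
    have e2 : (m : ℝ) * θ = ((m + 1 : ℕ) : ℝ) * θ - θ := by push_cast; ring
    rw [e1, e2, Real.cos_add, Real.cos_sub]
    ring

theorem re_zpow_of_re_eq_cos {q : SU2} {θ : ℝ} (h : (q : ℍ[ℝ]).re = Real.cos θ) (m : ℤ) :
    ((q ^ m : SU2) : ℍ[ℝ]).re = Real.cos (m * θ) := by
  cases m with
  | ofNat m => simpa using re_pow_of_re_eq_cos h m
  | negSucc m =>
    rw [zpow_negSucc, coe_inv, Quaternion.re_star, re_pow_of_re_eq_cos h, Int.cast_negSucc,
      neg_mul, Real.cos_neg]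

theorem angle_eq_arccos (a b : SU2) :
    InnerProductGeometry.angle (a : ℍ[ℝ]) b = Real.arccos ((a * star (b : ℍ[ℝ])).re) := by
  rw [InnerProductGeometry.angle, Quaternion.inner_def, mem_sphere_zero_iff_norm.1 a.2,
    mem_sphere_zero_iff_norm.1 b.2]
  simp

theorem cos_angle (a b : SU2) :
    Real.cos (InnerProductGeometry.angle (a : ℍ[ℝ]) b) = (a * star (b : ℍ[ℝ])).re := by
  rw [InnerProductGeometry.cos_angle, Quaternion.inner_def, mem_sphere_zero_iff_norm.1 a.2,
    mem_sphere_zero_iff_norm.1 b.2]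
  simp

/-- As `b⁻¹ = -b`, the real part is minus the inner product. The shift by `π` is the source of the
term `p_i π` in the congruences. -/
theorem re_mul_eq_cos {a b : SU2} (hb : (b : ℍ[ℝ]).re = 0) :
    ((a * b : SU2) : ℍ[ℝ]).re =
      Real.cos (π - InnerProductGeometry.angle (a : ℍ[ℝ]) b) := by
  rw [Real.cos_pi_sub, cos_angle, coe_mul, ← coe_inv, re_eq_zero_iff_inv.1 hb, coe_neg]
  simp

theorem angle_conj (g a b : SU2) :
    InnerProductGeometry.angle ((g * a * g⁻¹ : SU2) : ℍ[ℝ]) ((g * b * g⁻¹ : SU2) : ℍ[ℝ]) =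
      InnerProductGeometry.angle (a : ℍ[ℝ]) b := by
  rw [angle_eq_arccos, angle_eq_arccos, ← coe_inv, ← coe_inv, ← coe_mul, ← coe_mul,
    ← re_conj g (a * b⁻¹)]
  rw [show g * a * g⁻¹ * (g * b * g⁻¹)⁻¹ = g * (a * b⁻¹) * g⁻¹ by group]

/-- A unit quaternion is `±1` as soon as its real part is, so only the cosine of the multiplied
angle matters and no axis is needed. -/
theorem mul_zpow_eq_one_iff {a b : SU2} (hb : (b : ℍ[ℝ]).re = 0) (m : ℤ) :
    (a * b) ^ m = 1 ↔ (m : ℝ) * InnerProductGeometry.angle (a : ℍ[ℝ]) b ≡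
      ((m + 0 : ℤ) : ℝ) * π [PMOD (2 * π)] := by
  rw [eq_one_iff_re, re_zpow_of_re_eq_cos (re_mul_eq_cos hb), Real.cos_eq_one_iff,
    AddCommGroup.modEq_iff_zsmul]
  refine exists_congr fun k => ?_
  rw [zsmul_eq_mul, add_zero, mul_sub]

theorem mul_zpow_eq_neg_one_iff {a b : SU2} (hb : (b : ℍ[ℝ]).re = 0) (m : ℤ) :
    (a * b) ^ m = -1 ↔ (m : ℝ) * InnerProductGeometry.angle (a : ℍ[ℝ]) b ≡
      ((m + 1 : ℤ) : ℝ) * π [PMOD (2 * π)] := by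
  rw [eq_neg_one_iff_re, re_zpow_of_re_eq_cos (re_mul_eq_cos hb), Real.cos_eq_neg_one_iff,
    AddCommGroup.modEq_iff_zsmul]
  constructor
  · rintro ⟨k, hk⟩
    refine ⟨k + 1, ?_⟩
    rw [zsmul_eq_mul]
    push_cast
    linear_combination hk
  · rintro ⟨k, hk⟩
    refine ⟨k - 1, ?_⟩
    rw [zsmul_eq_mul] at hk
    push_cast at hk ⊢
    linear_combination hk

theorem exp_smul_qI {α : ℝ} (hα : 0 ≤ α) :
    NormedSpace.exp (α • qI) = mkQ (Real.cos α) (Real.sin α) 0 0 := by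
  have hn : ‖α • qI‖ = α := by
    rw [norm_smul, ← unitI_coe, mem_sphere_zero_iff_norm.1 unitI.2, mul_one, Real.norm_of_nonneg hα]
  rw [Quaternion.exp_of_re_eq_zero _ (by simp), hn]
  rcases hα.eq_or_lt with rfl | h
  · ext <;> simp
  · ext <;> simp [h.ne']

end SU2

/-! ### Elements that are inverted by conjugation -/

section Inverted

variable {G : Type*} [Group G] {a u : G}

theorem mul_zpow_of_inverted (h : a * u * a⁻¹ = u⁻¹) (m : ℤ) : a * u ^ m = u ^ (-m) * a := by
  rw [← mul_inv_eq_iff_eq_mul, ← conj_zpow, h, inv_zpow, zpow_neg]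

theorem inv_zpow_mul_of_inverted (h : a * u * a⁻¹ = u⁻¹) (m : ℤ) :
    (u ^ m * a)⁻¹ = u ^ m * a⁻¹ := by
  rw [mul_inv_rev, inv_mul_eq_iff_eq_mul, ← mul_assoc, mul_zpow_of_inverted h,
    mul_inv_cancel_right, zpow_neg]

/-- The elements `u^k a` behave like reflections of a dihedral group: conjugating one by another
reflects the exponent `k` in `m`. This describes the under-strand at a crossing. -/
theorem inv_conj_zpow_mul_of_inverted (h : a * u * a⁻¹ = u⁻¹) (m k : ℤ) :
    (u ^ m * a)⁻¹ * (u ^ k * a) * (u ^ m * a) = u ^ (2 * m - k) * a := by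
  rw [inv_zpow_mul_of_inverted h]
  have h1 : u ^ k * a = a * u ^ (-k) := by rw [mul_zpow_of_inverted h, neg_neg]
  rw [h1, mul_assoc, mul_assoc, mul_assoc, inv_mul_cancel_left, ← mul_assoc, ← mul_assoc,
    ← zpow_add, ← zpow_add]
  congr 2
  ring

theorem conj_zpow_mul_of_inverted (h : a * u * a⁻¹ = u⁻¹) (m k : ℤ) :
    (u ^ m * a) * (u ^ k * a) * (u ^ m * a)⁻¹ = u ^ (2 * m - k) * a := by
  rw [inv_zpow_mul_of_inverted h]
  rw [show u ^ m * a * (u ^ k * a) * (u ^ m * a⁻¹) =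
      u ^ m * a * (u ^ k * (a * u ^ m)) * a⁻¹ by group,
    mul_zpow_of_inverted h,
    show u ^ m * a * (u ^ k * (u ^ (-m) * a)) * a⁻¹ = u ^ m * (a * u ^ (k - m)) by group,
    mul_zpow_of_inverted h, ← mul_assoc, ← zpow_add]
  congr 2
  ring

end Inverted

/-! ### Products of two imaginary units -/

namespace SU2

theorem conj_mul_of_re_eq_zero {a b : SU2} (ha : (a : ℍ[ℝ]).re = 0) (hb : (b : ℍ[ℝ]).re = 0) :
    a * (a * b) * a⁻¹ = (a * b)⁻¹ := by
  rw [mul_inv_rev, re_eq_zero_iff_inv.1 hb, ← mul_assoc, mul_self_of_re_eq_zero ha, neg_one_mul]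

theorem re_zpow_mul_of_re_eq_zero {a b : SU2} (ha : (a : ℍ[ℝ]).re = 0) (hb : (b : ℍ[ℝ]).re = 0)
    (m : ℤ) : (((a * b) ^ m * a : SU2) : ℍ[ℝ]).re = 0 := by
  rw [re_eq_zero_iff_inv, inv_zpow_mul_of_inverted (conj_mul_of_re_eq_zero ha hb),
    re_eq_zero_iff_inv.1 ha, mul_neg]

end SU2

variable {n : ℕ} [NeZero n] {p : Fin n → ℤ}

/-! ### Relations between the meridians -/

section Relations

variable (p)

theorem meridian_top (i : Fin n) : meridian p (edgeR p i 0) = (sGen p (i + 1))⁻¹ := by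
  have h := PresentedGroup.one_of_mem (rels := {r | WirtingerRelator p r}) (.top i)
  rw [map_mul] at h
  exact eq_inv_of_mul_eq_one_left h

theorem meridian_bottom (i : Fin n) :
    meridian p (edgeR p i (Fin.last _)) = (meridian p (edgeL p (i + 1) (Fin.last _)))⁻¹ := by
  have h := PresentedGroup.one_of_mem (rels := {r | WirtingerRelator p r}) (.bottom i)
  rw [map_mul] at h
  exact eq_inv_of_mul_eq_one_left h

theorem meridian_posOver (i : Fin n) (hi : 0 < p i) (k : Fin (p i).natAbs) :
    meridian p (edgeR p i k.succ) = meridian p (edgeL p i k.castSucc) := by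
  have h := PresentedGroup.one_of_mem (rels := {r | WirtingerRelator p r}) (.posOver i hi k)
  rw [map_mul, map_inv] at h
  exact inv_mul_eq_one.1 h

theorem meridian_posUnder (i : Fin n) (hi : 0 < p i) (k : Fin (p i).natAbs) :
    meridian p (edgeL p i k.succ) = (meridian p (edgeL p i k.castSucc))⁻¹ *
      meridian p (edgeR p i k.castSucc) * meridian p (edgeL p i k.castSucc) := by
  have h := PresentedGroup.one_of_mem (rels := {r | WirtingerRelator p r}) (.posUnder i hi k)
  rw [map_mul, map_inv, map_mul, map_mul, map_inv] at h
  exact inv_mul_eq_one.1 h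

theorem meridian_negOver (i : Fin n) (hi : p i < 0) (k : Fin (p i).natAbs) :
    meridian p (edgeL p i k.succ) = meridian p (edgeR p i k.castSucc) := by
  have h := PresentedGroup.one_of_mem (rels := {r | WirtingerRelator p r}) (.negOver i hi k)
  rw [map_mul, map_inv] at h
  exact inv_mul_eq_one.1 h

theorem meridian_negUnder (i : Fin n) (hi : p i < 0) (k : Fin (p i).natAbs) :
    meridian p (edgeR p i k.succ) = meridian p (edgeR p i k.castSucc) *
      meridian p (edgeL p i k.castSucc) * (meridian p (edgeR p i k.castSucc))⁻¹ := by
  have h := PresentedGroup.one_of_mem (rels := {r | WirtingerRelator p r}) (.negUnder i hi k)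
  rw [map_mul, map_inv, map_mul, map_mul, map_inv] at h
  exact inv_mul_eq_one.1 h

end Relations

/-! ### Representations and their values on the meridians `s_i` -/

/-- The exponent `m` for which the meridian of the edge `e` of column `i` is mapped to
`(z_i z_{i+1})^m z_i`. -/
def edgeExponent (e : PretzelEdge p) : ℤ :=
  (p e.col).sign * (e.level : ℕ) - if e.right then 1 else 0

/-- The image of the meridian of the edge `e` under the representation with `s_i ↦ z_i`. -/
def edgeValue (p : Fin n → ℤ) (z : Fin n → SU2) (e : PretzelEdge p) : SU2 :=
  (z e.col * z (e.col + 1)) ^ edgeExponent e * z e.col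

theorem edgeValue_L (z : Fin n → SU2) (i : Fin n) (k : Fin ((p i).natAbs + 1)) :
    edgeValue p z (edgeL p i k) = (z i * z (i + 1)) ^ ((p i).sign * (k : ℕ)) * z i := by
  simp [edgeValue, edgeL, edgeExponent]

theorem edgeValue_R (z : Fin n → SU2) (i : Fin n) (k : Fin ((p i).natAbs + 1)) :
    edgeValue p z (edgeR p i k) = (z i * z (i + 1)) ^ ((p i).sign * (k : ℕ) - 1) * z i := by
  simp [edgeValue, edgeR, edgeExponent]

theorem mul_zpow_sub_one_mul {G : Type*} [Group G] (a b : G) (m : ℤ) :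
    (a * b) ^ (m - 1) * a = (a * b) ^ m * b⁻¹ := by
  rw [zpow_sub_one, mul_assoc, mul_inv_rev, inv_mul_cancel_right]

theorem re_edgeValue {z : Fin n → SU2} (hz : ∀ i, (z i : ℍ[ℝ]).re = 0) (e : PretzelEdge p) :
    (edgeValue p z e : ℍ[ℝ]).re = 0 :=
  SU2.re_zpow_mul_of_re_eq_zero (hz _) (hz _) _

/-- At level `k` of a positive column the exponents are `k` on the left and `k - 1` on the right;
the under-strand gets `2k - (k - 1) = k + 1`. In a negative column they are `-k` and `-k - 1`, and
the under-strand gets `2(-k - 1) + k = -(k + 1) - 1`. -/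
theorem lift_edgeValue_relator {z : Fin n → SU2} (hz : ∀ i, (z i : ℍ[ℝ]).re = 0) {c : SU2}
    (hc : c = 1 ∨ c = -1) (hp : ∀ i, (z i * z (i + 1)) ^ p i = c) (r : FreeGroup (PretzelEdge p))
    (hr : r ∈ {r | WirtingerRelator p r}) : FreeGroup.lift (edgeValue p z) r = 1 := by
  have hu i := SU2.conj_mul_of_re_eq_zero (hz i) (hz (i + 1))
  rcases hr with i | i | ⟨i, hi, k⟩ | ⟨i, hi, k⟩ | ⟨i, hi, k⟩ | ⟨i, hi, k⟩ <;>
    simp only [map_mul, map_inv, FreeGroup.lift_apply_of, edgeValue_L, edgeValue_R]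
  · simp
  -- Only the bottom arcs use the power condition: the product is `c z_{i+1}⁻¹ c z_{i+1}`, which is
  -- `1` because `c = ±1`.
  · rw [mul_zpow_sub_one_mul, Fin.val_last, Fin.val_last, Int.sign_mul_natAbs, Int.sign_mul_natAbs,
      hp, hp]
    rcases hc with rfl | rfl <;> simp
  · rw [Int.sign_eq_one_of_pos hi, inv_mul_eq_one]
    simp
  · rw [inv_conj_zpow_mul_of_inverted (hu i), inv_mul_eq_one, Int.sign_eq_one_of_pos hi]
    congr 2
    simp
    ring
  · rw [Int.sign_eq_neg_one_of_neg hi, inv_mul_eq_one]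
    congr 2
    simp
    ring
  · rw [conj_zpow_mul_of_inverted (hu i), inv_mul_eq_one, Int.sign_eq_neg_one_of_neg hi]
    congr 2
    simp
    ring

/-- The representation with `s_i ↦ z_i`. -/
def repOfValues (z : Fin n → SU2) (hz : ∀ i, (z i : ℍ[ℝ]).re = 0) {c : SU2}
    (hc : c = 1 ∨ c = -1) (hp : ∀ i, (z i * z (i + 1)) ^ p i = c) : RepSpace p c :=
  ⟨PresentedGroup.toGroup (lift_edgeValue_relator hz hc hp), by
    have h (e : PretzelEdge p) :
        PresentedGroup.toGroup (lift_edgeValue_relator hz hc hp) (meridian p e) =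
          edgeValue p z e := PresentedGroup.toGroup.of _
    refine ⟨fun e => ?_, fun i => ?_⟩
    · rw [h, SU2.isConj_unitI_iff]
      exact re_edgeValue hz e
    · rw [map_zpow, map_mul, sGen, sGen, h, h, edgeValue_L, edgeValue_L]
      simpa using hp i⟩

theorem repOfValues_meridian (z : Fin n → SU2) (hz : ∀ i, (z i : ℍ[ℝ]).re = 0) {c : SU2}
    (hc : c = 1 ∨ c = -1) (hp : ∀ i, (z i * z (i + 1)) ^ p i = c) (e : PretzelEdge p) :
    (repOfValues z hz hc hp).1 (meridian p e) = edgeValue p z e :=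
  PresentedGroup.toGroup.of (lift_edgeValue_relator hz hc hp)

theorem repOfValues_sGen (z : Fin n → SU2) (hz : ∀ i, (z i : ℍ[ℝ]).re = 0) {c : SU2}
    (hc : c = 1 ∨ c = -1) (hp : ∀ i, (z i * z (i + 1)) ^ p i = c) (i : Fin n) :
    (repOfValues z hz hc hp).1 (sGen p i) = z i := by
  rw [sGen, repOfValues_meridian, edgeValue_L]
  simp

/-- Induction down the column. It needs only that the `s_i` have imaginary values; a column with `p
i = 0` has no crossing. -/
theorem meridian_eq_edgeValue (ρ : PretzelGroup p →* SU2)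
    (hρ : ∀ i, (ρ (sGen p i) : ℍ[ℝ]).re = 0) (e : PretzelEdge p) :
    ρ (meridian p e) = edgeValue p (fun i => ρ (sGen p i)) e := by
  suffices h : ∀ (i : Fin n) (k : Fin ((p i).natAbs + 1)),
      ρ (meridian p (edgeL p i k)) = edgeValue p (fun i => ρ (sGen p i)) (edgeL p i k) ∧
      ρ (meridian p (edgeR p i k)) = edgeValue p (fun i => ρ (sGen p i)) (edgeR p i k) by
    obtain ⟨i, k, b⟩ := e
    cases b
    exacts [(h i k).1, (h i k).2]
  intro i k
  have hu := SU2.conj_mul_of_re_eq_zero (hρ i) (hρ (i + 1))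
  induction k using Fin.induction with
  | zero =>
    rw [edgeValue_L, edgeValue_R, meridian_top, ← sGen, mul_zpow_sub_one_mul]
    simp
  | succ k ih =>
    rw [edgeValue_L, edgeValue_R] at ih ⊢
    rcases lt_trichotomy (p i) 0 with hi | hi | hi
    · rw [meridian_negOver p i hi, meridian_negUnder p i hi, map_mul, map_mul, map_inv, ih.1, ih.2,
        conj_zpow_mul_of_inverted hu, Int.sign_eq_neg_one_of_neg hi]
      constructor
      · congr 2
        simp
        ring
      · congr 2
        simp
        ring
    · exact absurd k.2 (by simp [hi])
    · rw [meridian_posOver p i hi, meridian_posUnder p i hi, map_mul, map_mul, map_inv, ih.1, ih.2,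
        inv_conj_zpow_mul_of_inverted hu, Int.sign_eq_one_of_pos hi]
      constructor
      · congr 2
        simp
        ring
      · simp

/-! ### Representations are determined by their values on the `s_i` -/

namespace RepSpace

variable {c : SU2}

theorem re_meridian (ρ : RepSpace p c) (e : PretzelEdge p) : (ρ.1 (meridian p e) : ℍ[ℝ]).re = 0 :=
  SU2.isConj_unitI_iff.1 (ρ.2.1 e)

theorem re_sGen (ρ : RepSpace p c) (i : Fin n) : (ρ.1 (sGen p i) : ℍ[ℝ]).re = 0 :=
  ρ.re_meridian _

theorem ext_sGen {ρ ρ' : RepSpace p c} (h : ∀ i, ρ.1 (sGen p i) = ρ'.1 (sGen p i)) : ρ = ρ' := by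
  refine Subtype.ext (PresentedGroup.ext fun e => ?_)
  change ρ.1 (meridian p e) = ρ'.1 (meridian p e)
  rw [meridian_eq_edgeValue _ ρ.re_sGen, meridian_eq_edgeValue _ ρ'.re_sGen, funext h]

/-- The conjugate of a representation. -/
def conj (g : SU2) (ρ : RepSpace p c) (hc : c = 1 ∨ c = -1) : RepSpace p c :=
  ⟨(MulAut.conj g).toMonoidHom.comp ρ.1, by
    refine ⟨fun e => ?_, fun i => ?_⟩
    · rw [SU2.isConj_unitI_iff]
      exact (SU2.re_conj _ _).trans (ρ.re_meridian e)
    · change g * ρ.1 _ * g⁻¹ = c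
      rw [ρ.2.2]
      rcases hc with rfl | rfl <;> simp⟩

theorem conj_equiv (g : SU2) (ρ : RepSpace p c) (hc : c = 1 ∨ c = -1) : ρ.conj g hc ≈ ρ :=
  Setoid.symm (show ρ ≈ ρ.conj g hc from ⟨g, fun _ => rfl⟩)

theorem equiv_of_sGen {ρ ρ' : RepSpace p c} (hc : c = 1 ∨ c = -1) (g : SU2)
    (h : ∀ i, ρ'.1 (sGen p i) = g * ρ.1 (sGen p i) * g⁻¹) : ρ ≈ ρ' := by
  have : ρ' = ρ.conj g hc := ext_sGen h
  exact ⟨g, fun x => by rw [this]; rfl⟩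

end RepSpace

/-! ### Changing the signs of all meridians -/

/-- The homomorphism to `{1, -1}` that sends each meridian to `-1`. -/
def meridianSign (p : Fin n → ℤ) : PretzelGroup p →* ℤˣ :=
  PresentedGroup.toGroup (f := fun _ => -1) (by
    -- Every relator contains an even number of generators, counted with inverses.
    rintro r (i | i | i | i | i | i) <;> simp)

theorem meridianSign_meridian (e : PretzelEdge p) : meridianSign p (meridian p e) = -1 :=
  PresentedGroup.toGroup.of _

/-- The product of a representation with the sign homomorphism. -/
def signTwist (ρ : PretzelGroup p →* SU2) : PretzelGroup p →* SU2 where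
  toFun x := if meridianSign p x = 1 then ρ x else -ρ x
  map_one' := by simp
  map_mul' x y := by
    rcases Int.units_eq_one_or (meridianSign p x) with hx | hx <;>
      rcases Int.units_eq_one_or (meridianSign p y) with hy | hy <;> simp [hx, hy]

theorem signTwist_apply (ρ : PretzelGroup p →* SU2) (x : PretzelGroup p) :
    signTwist ρ x = if meridianSign p x = 1 then ρ x else -ρ x := rfl

theorem signTwist_meridian (ρ : PretzelGroup p →* SU2) (e : PretzelEdge p) :
    signTwist ρ (meridian p e) = -ρ (meridian p e) := by
  rw [signTwist_apply, meridianSign_meridian, if_neg (by decide)]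

theorem signTwist_signTwist (ρ : PretzelGroup p →* SU2) : signTwist (signTwist ρ) = ρ := by
  ext1 x
  simp only [signTwist_apply]
  split_ifs <;> simp

namespace RepSpace

variable {c : SU2}

/-- The product of a representation with the sign homomorphism. -/
def twist (ρ : RepSpace p c) : RepSpace p c :=
  ⟨signTwist ρ.1, by
    refine ⟨fun e => ?_, fun i => ?_⟩
    · rw [SU2.isConj_unitI_iff, signTwist_meridian, SU2.coe_neg, Quaternion.re_neg,
        ρ.re_meridian, neg_zero]
    · rw [map_zpow, map_mul, sGen, sGen, signTwist_meridian, signTwist_meridian, neg_mul_neg,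
        ← map_mul, ← map_zpow]
      exact ρ.2.2 i⟩

theorem twist_meridian (ρ : RepSpace p c) (e : PretzelEdge p) :
    ρ.twist.1 (meridian p e) = -ρ.1 (meridian p e) := signTwist_meridian _ _

theorem twist_sGen (ρ : RepSpace p c) (i : Fin n) : ρ.twist.1 (sGen p i) = -ρ.1 (sGen p i) :=
  ρ.twist_meridian _

theorem twist_equiv {ρ ρ' : RepSpace p c} (h : ρ ≈ ρ') : ρ.twist ≈ ρ'.twist := by
  obtain ⟨g, hg⟩ := h
  refine ⟨g, fun x => ?_⟩
  change signTwist ρ'.1 x = g * signTwist ρ.1 x * g⁻¹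
  rw [signTwist_apply, signTwist_apply]
  split_ifs <;> simp [hg]

theorem twist_twist (ρ : RepSpace p c) : ρ.twist.twist = ρ := Subtype.ext (signTwist_signTwist _)

theorem continuous_twist : Continuous (twist : RepSpace p c → RepSpace p c) := by
  refine continuous_induced_rng.2 (continuous_pi fun x => ?_)
  have hx : Continuous fun ρ : RepSpace p c => ρ.1 x :=
    (continuous_apply x).comp continuous_induced_dom
  change Continuous fun ρ : RepSpace p c => if meridianSign p x = 1 then ρ.1 x else -ρ.1 x
  split_ifs
  exacts [hx, hx.neg]

end RepSpace

namespace RepClass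

variable {c : SU2}

/-- The involution of the space of conjugacy classes given by the sign homomorphism. -/
def twist : RepClass p c → RepClass p c :=
  Quotient.map RepSpace.twist fun _ _ => RepSpace.twist_equiv

theorem twist_mk (ρ : RepSpace p c) : twist (⟦ρ⟧ : RepClass p c) = ⟦ρ.twist⟧ := rfl

theorem continuous_twist : Continuous (twist : RepClass p c → RepClass p c) :=
  RepSpace.continuous_twist.quotient_map' _

theorem involutive_twist : Function.Involutive (twist : RepClass p c → RepClass p c) := by
  rintro ⟨ρ⟩
  change twist (twist ⟦ρ⟧) = ⟦ρ⟧
  rw [twist_mk, twist_mk, RepSpace.twist_twist]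

end RepClass

namespace SU2

/-! ### The circle through `i` -/

/-- The unit quaternion `e^{iα}`. -/
def expI (α : ℝ) : SU2 := ofCoords (Real.cos α) (Real.sin α) 0 0 (by simp)

@[simp] theorem expI_re (α : ℝ) : (expI α : ℍ[ℝ]).re = Real.cos α := rfl
@[simp] theorem expI_imI (α : ℝ) : (expI α : ℍ[ℝ]).imI = Real.sin α := rfl
@[simp] theorem expI_imJ (α : ℝ) : (expI α : ℍ[ℝ]).imJ = 0 := rfl
@[simp] theorem expI_imK (α : ℝ) : (expI α : ℍ[ℝ]).imK = 0 := rfl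
@[simp] theorem unitI_re : (unitI : ℍ[ℝ]).re = 0 := rfl
@[simp] theorem unitI_imI : (unitI : ℍ[ℝ]).imI = 1 := rfl
@[simp] theorem unitI_imJ : (unitI : ℍ[ℝ]).imJ = 0 := rfl
@[simp] theorem unitI_imK : (unitI : ℍ[ℝ]).imK = 0 := rfl
@[simp] theorem unitJ_re : (unitJ : ℍ[ℝ]).re = 0 := rfl
@[simp] theorem unitJ_imI : (unitJ : ℍ[ℝ]).imI = 0 := rfl
@[simp] theorem unitJ_imJ : (unitJ : ℍ[ℝ]).imJ = 1 := rfl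
@[simp] theorem unitJ_imK : (unitJ : ℍ[ℝ]).imK = 0 := rfl

theorem coe_expI {α : ℝ} (hα : 0 ≤ α) : (expI α : ℍ[ℝ]) = NormedSpace.exp (α • qI) :=
  (exp_smul_qI hα).symm

theorem expI_zero : expI 0 = 1 := by
  rw [eq_one_iff_re]; simp

theorem expI_pi : expI π = -1 := by
  rw [eq_neg_one_iff_re]; simp

theorem unitI_commute_expI (α : ℝ) : Commute unitI (expI α) := by
  apply Subtype.ext
  rw [coe_mul, coe_mul]
  ext <;> simp

/-- Commuting with two different axes forces `g` to be real. -/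
theorem commute_of_commute_unitJ_expI {g : SU2} {α : ℝ} (hα : Real.sin α ≠ 0)
    (hJ : Commute g unitJ) (hα' : Commute g (expI α)) (q : SU2) : Commute g q := by
  have h1 := congrArg (fun q : SU2 => (q : ℍ[ℝ]).imK) hJ.eq
  have h2 := congrArg (fun q : SU2 => (q : ℍ[ℝ]).imI) hJ.eq
  have h3 := congrArg (fun q : SU2 => (q : ℍ[ℝ]).imK) hα'.eq
  simp only [coe_mul] at h1 h2 h3
  simp at h1 h2 h3
  have e1 : (g : ℍ[ℝ]).imI = 0 := by linarith
  have e2 : (g : ℍ[ℝ]).imK = 0 := by linarith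
  rw [e2] at h3
  have e3 : (g : ℍ[ℝ]).imJ = 0 := by
    have : Real.sin α * (g : ℍ[ℝ]).imJ = 0 := by linarith
    exact (mul_eq_zero.1 this).resolve_left hα
  apply Subtype.ext
  rw [coe_mul, coe_mul]
  ext <;> simp [e1, e2, e3] <;> ring

theorem mem_jCircle_of_conj {q : SU2} (h : unitI * q * unitI⁻¹ = -q) : q ∈ jCircle := by
  rw [mul_inv_eq_iff_eq_mul] at h
  have h0 := congrArg (fun q : SU2 => (q : ℍ[ℝ]).re) h
  have h1 := congrArg (fun q : SU2 => (q : ℍ[ℝ]).imI) h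
  simp only [coe_mul, coe_neg] at h0 h1
  simp at h0 h1
  exact ⟨by linarith, by linarith⟩

theorem conj_of_mem_jCircle {q : SU2} (h : q ∈ jCircle) : unitI * q * unitI⁻¹ = -q := by
  rw [mul_inv_eq_iff_eq_mul]
  apply Subtype.ext
  rw [coe_mul, coe_mul, coe_neg]
  ext <;> simp [h.1, h.2]

theorem conj_unitJ_of_imI {q : SU2} (h0 : (q : ℍ[ℝ]).re = 0) (h2 : (q : ℍ[ℝ]).imJ = 0) :
    unitJ * q * unitJ⁻¹ = -q := by
  rw [mul_inv_eq_iff_eq_mul]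
  apply Subtype.ext
  rw [coe_mul, coe_mul, coe_neg]
  ext <;> simp [h0, h2]

theorem coe_conj_unitI_neg {q : SU2} (h : (q : ℍ[ℝ]).re = 0) :
    ((unitI * -q * unitI⁻¹ : SU2) : ℍ[ℝ]) = reflJK q := by
  rw [coe_mul, coe_mul, coe_neg, coe_inv]
  ext <;> simp [h]

theorem angle_mem (a b : SU2) : 0 ≤ InnerProductGeometry.angle (a : ℍ[ℝ]) b ∧
    InnerProductGeometry.angle (a : ℍ[ℝ]) b ≤ π :=
  ⟨InnerProductGeometry.angle_nonneg _ _, InnerProductGeometry.angle_le_pi _ _⟩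

theorem eq_of_angle_eq_zero {a b : SU2} (h : InnerProductGeometry.angle (a : ℍ[ℝ]) b = 0) :
    b = a := by
  have := cos_angle a b
  rw [h, Real.cos_zero, ← coe_inv, ← coe_mul] at this
  exact (mul_inv_eq_one.1 ((eq_one_iff_re _).2 this.symm)).symm

theorem eq_of_angle_eq_pi {a b : SU2} (h : InnerProductGeometry.angle (a : ℍ[ℝ]) b = π) :
    b = -a := by
  have := cos_angle a b
  rw [h, Real.cos_pi, ← coe_inv, ← coe_mul] at this
  have := (eq_neg_one_iff_re _).2 this.symm
  rw [mul_inv_eq_iff_eq_mul, neg_one_mul] at this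
  rw [this, neg_neg]

theorem sin_angle_ne_zero {a b : SU2} (h0 : InnerProductGeometry.angle (a : ℍ[ℝ]) b ≠ 0)
    (hπ : InnerProductGeometry.angle (a : ℍ[ℝ]) b ≠ π) :
    Real.sin (InnerProductGeometry.angle (a : ℍ[ℝ]) b) ≠ 0 :=
  (Real.sin_pos_of_pos_of_lt_pi ((angle_mem a b).1.lt_of_ne' h0)
    ((angle_mem a b).2.lt_of_ne hπ)).ne'

/-- If `a` and `b` commute, `(ab)² = a² b² = 1`, so `cos 2(π - α) = 1` and `sin α = 0`. -/
theorem angle_of_commute {a b : SU2} (ha : (a : ℍ[ℝ]).re = 0) (hb : (b : ℍ[ℝ]).re = 0)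
    (h : Commute a b) : InnerProductGeometry.angle (a : ℍ[ℝ]) b = 0 ∨
      InnerProductGeometry.angle (a : ℍ[ℝ]) b = π := by
  by_contra! hne
  apply sin_angle_ne_zero hne.1 hne.2
  have h2 : (a * b) ^ 2 = 1 := by
    rw [h.mul_pow, sq, sq, mul_self_of_re_eq_zero ha, mul_self_of_re_eq_zero hb, neg_one_mul,
      neg_neg]
  have := re_pow_of_re_eq_cos (re_mul_eq_cos (a := a) hb) 2
  rw [h2, (eq_one_iff_re 1).1 rfl, Nat.cast_ofNat, Real.cos_two_mul, Real.cos_pi_sub] at this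
  have := Real.sin_sq_add_cos_sq (InnerProductGeometry.angle (a : ℍ[ℝ]) b)
  nlinarith

end SU2

/-! ### The two sign cases -/

theorem fin_exists_first {m : ℕ} {P : Fin m → Prop} (h : ∃ i, ¬ P i) :
    ∃ l, ¬ P l ∧ ∀ t < l, P t := by
  obtain ⟨l, hl, hmin⟩ := WellFounded.has_min (wellFounded_lt (α := Fin m)) {i | ¬ P i} h
  exact ⟨l, hl, fun t ht => by_contra fun hP => hmin t hP ht⟩

/-- The two cases of the correspondence. -/
def IsSignCase (c : SU2) (d : ℤ) (E : Set ℝ) : Prop :=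
  (c = 1 ∧ d = 0 ∧ E = {0, π}) ∨ (c = -1 ∧ d = 1 ∧ E = {0})

namespace IsSignCase

variable {c : SU2} {d : ℤ} {E : Set ℝ}

theorem central (h : IsSignCase c d E) : c = 1 ∨ c = -1 := h.imp And.left And.left

theorem zpow_eq_iff (h : IsSignCase c d E) {a b : SU2} (hb : (b : ℍ[ℝ]).re = 0) (m : ℤ) :
    (a * b) ^ m = c ↔ (m : ℝ) * InnerProductGeometry.angle (a : ℍ[ℝ]) b ≡
      ((m + d : ℤ) : ℝ) * π [PMOD (2 * π)] := by
  rcases h with ⟨rfl, rfl, -⟩ | ⟨rfl, rfl, -⟩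
  exacts [SU2.mul_zpow_eq_one_iff hb m, SU2.mul_zpow_eq_neg_one_iff hb m]

/-- At `α = π` one has `b = -a`, so `ab = 1`, whose powers never equal `-1`. -/
theorem angle_ne_pi (hc : c = -1) {a b : SU2} (hb : (b : ℍ[ℝ]).re = 0) {m : ℤ}
    (hm : (a * b) ^ m = c) : InnerProductGeometry.angle (a : ℍ[ℝ]) b ≠ π := by
  intro hπ
  have := SU2.re_mul_eq_cos (a := a) hb
  rw [hπ, sub_self, Real.cos_zero] at this
  rw [(SU2.eq_one_iff_re _).2 this, one_zpow, hc] at hm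
  exact SU2.one_ne_neg_one hm

/-- This lets both cases be treated alike: membership in `E` means that the two vertices are equal
or antipodal, although `π` is listed only in the case `+1`. -/
theorem mem_iff (h : IsSignCase c d E) {a b : SU2} (hb : (b : ℍ[ℝ]).re = 0) {m : ℤ}
    (hm : (a * b) ^ m = c) : InnerProductGeometry.angle (a : ℍ[ℝ]) b ∈ E ↔
      InnerProductGeometry.angle (a : ℍ[ℝ]) b = 0 ∨
        InnerProductGeometry.angle (a : ℍ[ℝ]) b = π := by
  rcases h with ⟨-, -, rfl⟩ | ⟨hc, -, rfl⟩
  · rfl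
  · simp [angle_ne_pi hc hb hm]

end IsSignCase

/-! ### Normalization of polygons -/

theorem sideLength_conj (g : SU2) (z : Fin n → SU2) (i : Fin n) :
    sideLength (fun i => g * z i * g⁻¹) i = sideLength z i := SU2.angle_conj g _ _

theorem sideLength_neg (z : Fin n → SU2) (i : Fin n) :
    sideLength (fun i => -z i) i = sideLength z i := InnerProductGeometry.angle_neg_neg _ _

theorem conjFixing_iff {E : Set ℝ} {z : Fin n → SU2} : ConjFixing E z ↔ z 0 = SU2.unitJ ∧
    ∀ m : Fin n, (∀ t : Fin n, t < m → sideLength z t ∈ E) →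
      z (m + 1) = z m * SU2.expI (sideLength z m) := by
  have h (m : Fin n) : z (m + 1) = z m * SU2.expI (sideLength z m) ↔
      (z (m + 1) : ℍ[ℝ]) = (z m : ℍ[ℝ]) * NormedSpace.exp (sideLength z m • qI) := by
    rw [Subtype.ext_iff, SU2.coe_mul, SU2.coe_expI (α := sideLength z m) (SU2.angle_mem _ _).1]
  simp only [h, Subtype.ext_iff, SU2.unitJ_coe]
  rfl

/-- Addition in `Fin n` is cyclic, but the induction only climbs from `0` to `m` and never wraps
around. -/
theorem fin_induction_upto {P Q : Fin n → Prop} (h0 : P 0)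
    (hs : ∀ i, P i → Q i → P (i + 1)) (m : Fin n) (hm : ∀ t < m, Q t) : P m := by
  obtain ⟨k, hk⟩ := m
  induction k with
  | zero => exact h0
  | succ k ih =>
    have hk' : k < n := by omega
    have e : (⟨k, hk'⟩ : Fin n) + 1 = ⟨k + 1, hk⟩ := Fin.ext (Fin.val_add_one_of_lt' hk)
    rw [← e]
    exact hs _ (ih hk' fun t ht => hm t (ht.trans (Nat.lt_succ_self k))) (hm _ (Nat.lt_succ_self k))

namespace IsSignCase

variable {c : SU2} {d : ℤ} {E : Set ℝ}

section Values

variable (h : IsSignCase c d E) {z : Fin n → SU2} (hz : ∀ i, (z i : ℍ[ℝ]).re = 0)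
  (hp : ∀ i, (z i * z (i + 1)) ^ p i = c)

include h hz hp

/-- For `α = 0` and `α = π` the factor `e^{iα}` is `±1`, so the normalization imposes nothing on
such sides. -/
theorem next_of_mem {i : Fin n} (hi : sideLength z i ∈ E) :
    z (i + 1) = z i * SU2.expI (sideLength z i) := by
  rcases (h.mem_iff (hz _) (hp i)).1 hi with h0 | h0
  · rw [sideLength, h0, SU2.expI_zero, mul_one, SU2.eq_of_angle_eq_zero h0]
  · rw [sideLength, h0, SU2.expI_pi, mul_neg, mul_one, SU2.eq_of_angle_eq_pi h0]

theorem eq_or_eq_neg_unitJ (h0 : z 0 = SU2.unitJ) (m : Fin n)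
    (hm : ∀ t < m, sideLength z t ∈ E) : z m = SU2.unitJ ∨ z m = -SU2.unitJ := by
  refine fin_induction_upto (P := fun m => z m = SU2.unitJ ∨ z m = -SU2.unitJ)
    (Q := fun t => sideLength z t ∈ E) (Or.inl h0) (fun i hi hE => ?_) m hm
  rcases (h.mem_iff (hz _) (hp i)).1 hE with h1 | h1
  · rwa [SU2.eq_of_angle_eq_zero h1]
  · rw [SU2.eq_of_angle_eq_pi h1, neg_inj, neg_eq_iff_eq_neg]
    exact hi.symm

theorem exists_conjFixing_of_zero (h0 : z 0 = SU2.unitJ) :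
    ∃ g : SU2, ConjFixing E fun i => g * z i * g⁻¹ := by
  by_cases hall : ∀ i, sideLength z i ∈ E
  · refine ⟨1, conjFixing_iff.2 ⟨by simpa using h0, fun m _ => ?_⟩⟩
    rw [sideLength_conj]
    simpa using h.next_of_mem hz hp (hall m)
  · push Not at hall
    obtain ⟨l, hl, hlt⟩ := fin_exists_first hall
    have hzl := h.eq_or_eq_neg_unitJ hz hp h0 l hlt
    have hcos : ((z l * z (l + 1) : SU2) : ℍ[ℝ]).re = -Real.cos (sideLength z l) := by
      rw [SU2.re_mul_eq_cos (hz _), Real.cos_pi_sub]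
      rfl
    -- As `z l = ±j`, the length of side `l` determines the `j`-coordinate of `z (l + 1)`, which is
    -- what a rotation about `j` preserves.
    obtain ⟨g, hgJ, hg⟩ := SU2.exists_conj_of_imJ_eq (a := z (l + 1))
        (b := z l * SU2.expI (sideLength z l)) (hz _)
        (by rcases hzl with hzl | hzl <;> rw [hzl] <;> simp only [SU2.coe_mul, SU2.coe_neg] <;> simp)
        (by
          rcases hzl with hzl | hzl <;> rw [hzl] at hcos ⊢ <;>
            simp only [SU2.coe_mul, SU2.coe_neg] at hcos ⊢ <;> simp at hcos ⊢ <;> linarith)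
    refine ⟨g, conjFixing_iff.2 ⟨by rw [h0, hgJ], fun m hm => ?_⟩⟩
    have hgm : g * z m * g⁻¹ = z m := by
      have hm' : ∀ t < m, sideLength z t ∈ E := fun t ht => sideLength_conj g z t ▸ hm t ht
      rcases h.eq_or_eq_neg_unitJ hz hp h0 m hm' with e | e <;> simp [e, hgJ]
    rw [sideLength_conj, hgm]
    -- Before `l` all vertices are `±j` and stay fixed; at `l` the rotation was chosen to fit; after
    -- `l` the condition is void.
    rcases lt_trichotomy m l with hml | rfl | hml
    · have hnext := h.next_of_mem hz hp (hlt m hml)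
      rw [← hnext]
      have hpm : z (m + 1) = z m ∨ z (m + 1) = -z m :=
        ((h.mem_iff (hz _) (hp m)).1 (hlt m hml)).imp SU2.eq_of_angle_eq_zero
          SU2.eq_of_angle_eq_pi
      rcases hpm with e | e <;> simp [e, hgm]
    · exact hg
    · exact absurd (sideLength_conj g z l ▸ hm l hml) hl

theorem exists_conjFixing : ∃ g : SU2, ConjFixing E fun i => g * z i * g⁻¹ := by
  obtain ⟨g, hg⟩ := isConj_iff.1 (SU2.isConj_of_re_eq_zero (hz 0) SU2.unitJ_re)
  obtain ⟨g', hg'⟩ := h.exists_conjFixing_of_zero (z := fun i => g * z i * g⁻¹)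
    (fun i => by rw [SU2.re_conj, hz])
    (fun i => by
      rw [show g * z i * g⁻¹ * (g * z (i + 1) * g⁻¹) = g * (z i * z (i + 1)) * g⁻¹ by group,
        conj_zpow, hp]
      rcases h.central with rfl | rfl <;> simp) hg
  refine ⟨g' * g, ?_⟩
  convert hg' using 2
  group

/-- Such a `g` commutes with `j`, which settles the case of vertices `±j`. Otherwise it also fixes
both ends of the first side outside `E`, hence commutes with `e^{iα}` where `sin α ≠ 0`, and so is
central. -/
theorem conjFixing_unique (hf : ConjFixing E z) (g : SU2)
    (hg : ConjFixing E fun i => g * z i * g⁻¹) (i : Fin n) : g * z i * g⁻¹ = z i := by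
  rw [conjFixing_iff] at hf hg
  have hgJ : g * SU2.unitJ * g⁻¹ = SU2.unitJ := by rw [← hf.1, hg.1, hf.1]
  have hfix (m : Fin n) (hm : ∀ t < m, sideLength z t ∈ E) : g * z m * g⁻¹ = z m := by
    rcases h.eq_or_eq_neg_unitJ hz hp hf.1 m hm with e | e <;> simp [e, hgJ]
  by_cases hall : ∀ i, sideLength z i ∈ E
  · exact hfix i fun t _ => hall t
  · push Not at hall
    obtain ⟨l, hl, hlt⟩ := fin_exists_first hall
    have h1 := hf.2 l hlt
    have h2 := hg.2 l fun t ht => by rw [sideLength_conj]; exact hlt t ht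
    rw [sideLength_conj, hfix l hlt, h1, mul_inv_eq_iff_eq_mul] at h2
    have hl' := hl
    rw [sideLength, h.mem_iff (hz _) (hp l), not_or] at hl'
    have hgl : Commute g (z l) := mul_inv_eq_iff_eq_mul.1 (hfix l hlt)
    have hge : Commute g (SU2.expI (sideLength z l)) := by
      have h3 : Commute g (z l * SU2.expI (sideLength z l)) := h2
      simpa using hgl.inv_right.mul_right h3
    rw [mul_inv_eq_iff_eq_mul]
    exact SU2.commute_of_commute_unitJ_expI (SU2.sin_angle_ne_zero hl'.1 hl'.2)
      (mul_inv_eq_iff_eq_mul.1 hgJ) hge (z i)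

end Values

end IsSignCase

variable {c : SU2} {d : ℤ} {E : Set ℝ}

/-! ### The correspondence between conjugacy classes and polygons -/

namespace NormalizedPolygon

theorem zpow_eq (h : IsSignCase c d E) (Z : NormalizedPolygon p d E) (i : Fin n) :
    (Z.1 i * Z.1 (i + 1)) ^ p i = c :=
  (h.zpow_eq_iff (Z.2.1 _) _).2 (Z.2.2.1 i)

/-- The representation with `ρ(s_i) = z_i`. -/
def toRep (h : IsSignCase c d E) (Z : NormalizedPolygon p d E) : RepSpace p c :=
  repOfValues Z.1 Z.2.1 h.central (Z.zpow_eq h)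

theorem toRep_sGen (h : IsSignCase c d E) (Z : NormalizedPolygon p d E) (i : Fin n) :
    (Z.toRep h).1 (sGen p i) = Z.1 i := repOfValues_sGen _ _ _ _ _

theorem toRep_meridian (h : IsSignCase c d E) (Z : NormalizedPolygon p d E) (e : PretzelEdge p) :
    (Z.toRep h).1 (meridian p e) = edgeValue p Z.1 e := repOfValues_meridian _ _ _ _ _

theorem bijective_toRep (h : IsSignCase c d E) :
    Function.Bijective fun Z : NormalizedPolygon p d E => (⟦Z.toRep h⟧ : RepClass p c) := by
  constructor
  · intro Z Z' hZ
    obtain ⟨g, hg⟩ := Quotient.exact hZ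
    have hgi (i : Fin n) : Z'.1 i = g * Z.1 i * g⁻¹ := by
      rw [← toRep_sGen h, hg, toRep_sGen]
    have hfix : ConjFixing E fun i => g * Z.1 i * g⁻¹ := by
      rw [← funext hgi]
      exact Z'.2.2.2
    refine Subtype.ext (funext fun i => ?_)
    rw [hgi, h.conjFixing_unique Z.2.1 (Z.zpow_eq h) Z.2.2.2 g hfix]
  · rintro ⟨ρ⟩
    have hp (i : Fin n) : (ρ.1 (sGen p i) * ρ.1 (sGen p (i + 1))) ^ p i = c := by
      rw [← map_mul, ← map_zpow]
      exact ρ.2.2 i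
    obtain ⟨g, hg⟩ := h.exists_conjFixing ρ.re_sGen hp
    refine ⟨⟨fun i => g * ρ.1 (sGen p i) * g⁻¹, fun i => ?_, fun i => ?_, hg⟩, ?_⟩
    · rw [SU2.re_conj, ρ.re_sGen]
    · rw [sideLength_conj]
      exact (h.zpow_eq_iff (ρ.re_sGen _) _).1 (hp i)
    · exact Quotient.sound (Setoid.symm (RepSpace.equiv_of_sGen h.central g fun i =>
        toRep_sGen h _ i))

/-- The reflected polygon. -/
def reflect (Z : NormalizedPolygon p d E) : NormalizedPolygon p d E :=
  -- Negation and conjugation preserve side lengths, and `i` commutes with `e^{iα}`, so the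
  -- normalization survives.
  ⟨fun i => unitI * -Z.1 i * unitI⁻¹, by
    have hs (i : Fin n) : sideLength (fun i => unitI * -Z.1 i * unitI⁻¹) i = sideLength Z.1 i := by
      rw [sideLength_conj unitI fun i => -Z.1 i, sideLength_neg]
    refine ⟨fun i => ?_, fun i => ?_, conjFixing_iff.2 ⟨?_, fun m hm => ?_⟩⟩
    · rw [SU2.re_conj, SU2.coe_neg, Quaternion.re_neg, Z.2.1, neg_zero]
    · rw [hs]
      exact Z.2.2.1 i
    · rw [(conjFixing_iff.1 Z.2.2.2).1, mul_neg, neg_mul,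
        SU2.conj_of_mem_jCircle (q := SU2.unitJ) ⟨rfl, rfl⟩, neg_neg]
    · simp only [hs] at hm ⊢
      rw [(conjFixing_iff.1 Z.2.2.2).2 m hm]
      have := ((SU2.unitI_commute_expI (sideLength Z.1 m)).inv_left).eq
      rw [mul_assoc _ unitI⁻¹, this]
      simp only [mul_neg, neg_mul, mul_assoc]⟩

theorem reflect_coe (Z : NormalizedPolygon p d E) (i : Fin n) :
    ((Z.reflect).1 i : ℍ[ℝ]) = reflJK (Z.1 i) := SU2.coe_conj_unitI_neg (Z.2.1 i)

theorem twist_toRep (h : IsSignCase c d E) (Z : NormalizedPolygon p d E) :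
    (Z.toRep h).twist ≈ (Z.reflect).toRep h :=
  RepSpace.equiv_of_sGen h.central unitI fun i => by
    rw [toRep_sGen, RepSpace.twist_sGen, toRep_sGen]
    rfl

/-- The bijection between conjugacy classes and normalized polygons. -/
def equivRepClass (h : IsSignCase c d E) : RepClass p c ≃ NormalizedPolygon p d E :=
  (Equiv.ofBijective _ (bijective_toRep h)).symm

theorem equivRepClass_eq_iff_mk (h : IsSignCase c d E) (C : RepClass p c)
    (Z : NormalizedPolygon p d E) : equivRepClass h C = Z ↔ C = ⟦Z.toRep h⟧ :=
  Equiv.symm_apply_eq _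

theorem equivRepClass_eq_iff (h : IsSignCase c d E) (ρ : RepSpace p c)
    (Z : NormalizedPolygon p d E) : equivRepClass h ⟦ρ⟧ = Z ↔
      ∃ ρ' : RepSpace p c, ρ' ≈ ρ ∧ ∀ i, ρ'.1 (sGen p i) = Z.1 i := by
  rw [equivRepClass_eq_iff_mk]
  constructor
  · intro hρ
    exact ⟨Z.toRep h, Setoid.symm (Quotient.exact hρ), Z.toRep_sGen h⟩
  · rintro ⟨ρ', hρ', hZ⟩
    rw [← RepSpace.ext_sGen (ρ := ρ') (ρ' := Z.toRep h) fun i => by rw [hZ, toRep_sGen]]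
    exact Quotient.sound (Setoid.symm hρ')

theorem toRep_equivRepClass (h : IsSignCase c d E) (ρ : RepSpace p c) :
    ρ ≈ (equivRepClass h ⟦ρ⟧).toRep h :=
  Quotient.exact ((equivRepClass_eq_iff_mk h _ _).1 rfl)

theorem equivRepClass_twist (h : IsSignCase c d E) (C : RepClass p c) :
    equivRepClass h (RepClass.twist C) = (equivRepClass h C).reflect := by
  rw [equivRepClass_eq_iff_mk]
  conv_lhs => rw [(equivRepClass_eq_iff_mk h C _).1 rfl]
  exact Quotient.sound (twist_toRep h _)

theorem twist_eq_self_iff (h : IsSignCase c d E) (C : RepClass p c) :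
    RepClass.twist C = C ↔ ∀ i, ((equivRepClass h C).1 i : ℍ[ℝ]).imI = 0 := by
  rw [← (equivRepClass h).injective.eq_iff, equivRepClass_twist]
  refine (Subtype.ext_iff.trans funext_iff).trans ?_
  refine forall_congr' fun i => ?_
  rw [Subtype.ext_iff, reflect_coe]
  constructor
  · intro hi
    have := congrArg (fun q : ℍ[ℝ] => q.imI) hi
    simp only [reflJK_imI] at this
    linarith
  · intro hi
    ext <;> simp [hi]

end NormalizedPolygon

/-! ### Abelian representations -/

namespace IsAbelianRep

theorem of_equiv {ρ ρ' : RepSpace p c} (h : ρ ≈ ρ') (hρ : IsAbelianRep ρ.1) :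
    IsAbelianRep ρ'.1 := by
  obtain ⟨g, hg⟩ := h
  intro x y
  rw [hg, hg, conj_mul, conj_mul, hρ x y]

theorem signTwist {ρ : PretzelGroup p →* SU2} (hρ : IsAbelianRep ρ) :
    IsAbelianRep (signTwist ρ) := by
  intro x y
  simp only [signTwist_apply]
  split_ifs <;> simp [hρ x y]

end IsAbelianRep

theorem range_le_of_meridian {ρ : PretzelGroup p →* SU2} {H : Subgroup SU2}
    (h : ∀ e, ρ (meridian p e) ∈ H) : ρ.range ≤ H := by
  rw [MonoidHom.range_eq_map, ← PresentedGroup.closure_range_of, MonoidHom.map_closure,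
    Subgroup.closure_le]
  rintro _ ⟨_, ⟨e, rfl⟩, rfl⟩
  exact h e

theorem NormalizedPolygon.isAbelianRep_toRep_iff (h : IsSignCase c d E)
    (Z : NormalizedPolygon p d E) :
    IsAbelianRep (Z.toRep h).1 ↔ ∀ i, sideLength Z.1 i ∈ E := by
  constructor
  · intro hab i
    have := hab (sGen p i) (sGen p (i + 1))
    rw [toRep_sGen, toRep_sGen] at this
    exact (h.mem_iff (Z.2.1 _) (Z.zpow_eq h i)).2 (SU2.angle_of_commute (Z.2.1 _) (Z.2.1 _) this)
  · intro hE
    -- All vertices are `±j` and `-j = j⁻¹`, so the image lies in a cyclic group.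
    have hz (i : Fin n) : Z.1 i ∈ Subgroup.zpowers SU2.unitJ := by
      rcases h.eq_or_eq_neg_unitJ Z.2.1 (Z.zpow_eq h) (conjFixing_iff.1 Z.2.2.2).1 i
        fun t _ => hE t with e | e
      · rw [e]
        exact Subgroup.mem_zpowers _
      · rw [e, ← SU2.re_eq_zero_iff_inv.1 SU2.unitJ_re]
        exact inv_mem (Subgroup.mem_zpowers _)
    have hle : (Z.toRep h).1.range ≤ Subgroup.zpowers SU2.unitJ := range_le_of_meridian fun e => by
      rw [toRep_meridian]
      exact mul_mem (zpow_mem (mul_mem (hz _) (hz _)) _) (hz _)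
    intro x y
    obtain ⟨k, hk⟩ := hle ⟨x, rfl⟩
    obtain ⟨l, hl⟩ := hle ⟨y, rfl⟩
    rw [← hk, ← hl]
    exact (Commute.refl _).zpow_zpow k l

theorem isAbelianRep_iff (h : IsSignCase c d E) (ρ : RepSpace p c) :
    IsAbelianRep ρ.1 ↔ ∀ i, sideLength (NormalizedPolygon.equivRepClass h ⟦ρ⟧).1 i ∈ E := by
  rw [← NormalizedPolygon.isAbelianRep_toRep_iff h]
  have := NormalizedPolygon.toRep_equivRepClass h ρ
  exact ⟨.of_equiv this, .of_equiv (Setoid.symm this)⟩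

/-! ### Binary dihedral representations -/

theorem IsMeridionallyDihedral.isBinaryDihedral {ρ : PretzelGroup p →* SU2}
    (h : IsMeridionallyDihedral ρ) : IsBinaryDihedral ρ := by
  obtain ⟨g, hg⟩ := h
  refine ⟨g, range_le_of_meridian fun e => ?_⟩
  obtain ⟨q, hq, hqe⟩ := hg e
  exact ⟨q, Or.inr hq, hqe.symm⟩

/-- Conjugation by `i` negates every element of `j S¹`, so it realizes the sign change, after
transport by `g`. -/
theorem IsMeridionallyDihedral.twist_equiv {ρ : RepSpace p c} (hc : c = 1 ∨ c = -1)
    (h : IsMeridionallyDihedral ρ.1) : ρ.twist ≈ ρ := by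
  obtain ⟨g, hg⟩ := h
  refine Setoid.symm (RepSpace.equiv_of_sGen hc (g * unitI * g⁻¹) fun i => ?_)
  rw [RepSpace.twist_sGen]
  obtain ⟨q, hq, hqe⟩ := hg (edgeL p i 0)
  rw [sGen, hqe, show g * unitI * g⁻¹ * (g * q * g⁻¹) * (g * unitI * g⁻¹)⁻¹ =
    g * (unitI * q * unitI⁻¹) * g⁻¹ by group, SU2.conj_of_mem_jCircle hq]
  simp

theorem isMeridionallyDihedral_of_imI_eq_zero (h : IsSignCase c d E) {ρ : RepSpace p c}
    (hρ : ∀ i, ((NormalizedPolygon.equivRepClass h ⟦ρ⟧).1 i : ℍ[ℝ]).imI = 0) :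
    IsMeridionallyDihedral ρ.1 := by
  obtain ⟨g, hg⟩ := Setoid.symm (NormalizedPolygon.toRep_equivRepClass h ρ)
  set Z := NormalizedPolygon.equivRepClass h ⟦ρ⟧
  refine ⟨g, fun e => ⟨_, ?_, hg (meridian p e)⟩⟩
  apply SU2.mem_jCircle_of_conj
  rw [← RepSpace.twist_meridian]
  -- Conjugation by `i` and the sign change agree on the `s_i`, hence on all meridians; an element
  -- negated by this conjugation lies in `j S¹`.
  have : (Z.toRep h).conj unitI h.central = (Z.toRep h).twist := RepSpace.ext_sGen fun i => by
    change unitI * (Z.toRep h).1 (sGen p i) * unitI⁻¹ = _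
    rw [RepSpace.twist_sGen, Z.toRep_sGen, SU2.conj_of_mem_jCircle ⟨Z.2.1 i, hρ i⟩]
  rw [← this]
  rfl

theorem isMeridionallyDihedral_iff (h : IsSignCase c d E) (ρ : RepSpace p c) :
    IsMeridionallyDihedral ρ.1 ↔
      ∀ i, ((NormalizedPolygon.equivRepClass h ⟦ρ⟧).1 i : ℍ[ℝ]).imI = 0 := by
  refine ⟨fun hρ => ?_, isMeridionallyDihedral_of_imI_eq_zero h⟩
  rw [← NormalizedPolygon.twist_eq_self_iff]
  exact Quotient.sound (hρ.twist_equiv h.central)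

theorem conj_mem_jCircle {r q : SU2} (hr : r ∈ Pin2) (hq : q ∈ jCircle) :
    r * q * r⁻¹ ∈ jCircle := by
  refine ⟨by rw [SU2.re_conj, hq.1], ?_⟩
  rw [SU2.coe_mul, SU2.coe_mul, SU2.coe_inv]
  rcases hr with hr | hr <;> simp [hq.1, hq.2, hr.1, hr.2]

theorem conj_mem_jCircle_iff {r q : SU2} (hr : r ∈ Pin2) :
    r * q * r⁻¹ ∈ jCircle ↔ q ∈ jCircle := by
  refine ⟨fun h => ?_, conj_mem_jCircle hr⟩
  have := conj_mem_jCircle (inv_mem hr) h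
  rwa [show r⁻¹ * (r * q * r⁻¹) * r⁻¹⁻¹ = q by group] at this

theorem inv_mem_jCircle_iff {q : SU2} : q⁻¹ ∈ jCircle ↔ q ∈ jCircle := by
  change _ ∧ _ ↔ _ ∧ _
  rw [SU2.coe_inv]
  simp

/-! ### Strands of the link and the two components of `Pin2` -/

section Strands

variable {σ : PretzelGroup p →* SU2} (hσ : ∀ x, σ x ∈ Pin2)

include hσ

/-- Adjacent edges have meridians that are equal, inverse or conjugate in the group, and none of
this changes the component of `Pin2`. -/
theorem mem_jCircle_iff_of_strandAdj {e e' : PretzelEdge p} (h : StrandAdj p e e') :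
    σ (meridian p e) ∈ jCircle ↔ σ (meridian p e') ∈ jCircle := by
  have hinv {x y : PretzelGroup p} : σ (x * y * x⁻¹) ∈ jCircle ↔ σ y ∈ jCircle := by
    rw [map_mul, map_mul, map_inv, conj_mem_jCircle_iff (hσ x)]
  have hinv' {x y : PretzelGroup p} : σ (x⁻¹ * y * x) ∈ jCircle ↔ σ y ∈ jCircle := by
    simpa using hinv (x := x⁻¹) (y := y)
  rcases h with i | i | ⟨i, k⟩ | ⟨i, k⟩
  · rw [meridian_top, map_inv, inv_mem_jCircle_iff, sGen]
  · rw [meridian_bottom, map_inv, inv_mem_jCircle_iff]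
  · rcases lt_trichotomy (p i) 0 with hi | hi | hi
    · rw [meridian_negUnder p i hi, hinv]
    · exact absurd k.2 (by simp [hi])
    · rw [meridian_posOver p i hi]
  · rcases lt_trichotomy (p i) 0 with hi | hi | hi
    · rw [meridian_negOver p i hi]
    · exact absurd k.2 (by simp [hi])
    · rw [meridian_posUnder p i hi, hinv']

theorem mem_jCircle_iff_of_isPretzelKnot (hK : IsPretzelKnot p) (e e' : PretzelEdge p) :
    σ (meridian p e) ∈ jCircle ↔ σ (meridian p e') ∈ jCircle := by
  induction hK e e' with
  | rel _ _ h => exact mem_jCircle_iff_of_strandAdj hσ h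
  | refl => rfl
  | symm _ _ _ ih => exact ih.symm
  | trans _ _ _ _ _ ih ih' => exact ih.trans ih'

end Strands

theorem IsBinaryDihedral.twist_equiv (hK : IsPretzelKnot p) {ρ : RepSpace p c}
    (hc : c = 1 ∨ c = -1) (h : IsBinaryDihedral ρ.1) : ρ.twist ≈ ρ := by
  obtain ⟨g, hg⟩ := h
  refine Setoid.trans (RepSpace.twist_equiv (Setoid.symm (RepSpace.conj_equiv g⁻¹ ρ hc)))
    (Setoid.trans ?_ (RepSpace.conj_equiv g⁻¹ ρ hc))
  set σ := ρ.conj g⁻¹ hc with hσdef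
  have hσ (x : PretzelGroup p) : σ.1 x ∈ Pin2 := by
    obtain ⟨q, hq, hqx⟩ := hg ⟨x, rfl⟩
    have : σ.1 x = q := by
      change g⁻¹ * ρ.1 x * g⁻¹⁻¹ = q
      rw [← hqx]
      change g⁻¹ * (g * q * g⁻¹) * g⁻¹⁻¹ = q
      group
    rwa [this]
  by_cases h0 : σ.1 (sGen p 0) ∈ jCircle
  · exact IsMeridionallyDihedral.twist_equiv hc ⟨1, fun e => ⟨σ.1 (meridian p e),
      (mem_jCircle_iff_of_isPretzelKnot hσ hK _ e).1 h0, by simp⟩⟩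
  -- All meridians now lie in `S¹` and are imaginary, hence `±i`, and conjugation by `j` negates
  -- them.
  · refine Setoid.symm (RepSpace.equiv_of_sGen hc SU2.unitJ fun i => ?_)
    have hi : σ.1 (sGen p i) ∉ jCircle :=
      fun hi => h0 ((mem_jCircle_iff_of_isPretzelKnot hσ hK _ _).1 hi)
    rw [RepSpace.twist_sGen,
      SU2.conj_unitJ_of_imI (σ.re_sGen i) ((hσ (sGen p i)).resolve_right hi).1]

theorem isBinaryDihedral_iff (h : IsSignCase c d E) (hK : IsPretzelKnot p) (ρ : RepSpace p c) :
    IsBinaryDihedral ρ.1 ↔ IsMeridionallyDihedral ρ.1 := by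
  refine ⟨fun hρ => ?_, IsMeridionallyDihedral.isBinaryDihedral⟩
  rw [isMeridionallyDihedral_iff h, ← NormalizedPolygon.twist_eq_self_iff]
  exact Quotient.sound (hρ.twist_equiv hK h.central)

theorem twist_eq_self_iff_isMeridionallyDihedral (h : IsSignCase c d E) (ρ : RepSpace p c) :
    RepClass.twist (⟦ρ⟧ : RepClass p c) = ⟦ρ⟧ ↔ IsMeridionallyDihedral ρ.1 := by
  rw [isMeridionallyDihedral_iff h, NormalizedPolygon.twist_eq_self_iff h]

end

theorem proposition3p4 {n : ℕ} [NeZero n] (p : Fin n → ℤ) (c : SU2) (d : ℤ) (E : Set ℝ)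
    -- the case `+1` and the case `-1`
    (hcase : (c = 1 ∧ d = 0 ∧ E = {0, π}) ∨ (c = -1 ∧ d = 1 ∧ E = {0})) :
    ∃ (Φ : RepClass p c ≃ NormalizedPolygon p d E) (τ : RepClass p c → RepClass p c),
      -- `Φ` is the correspondence `z_i = ρ(s_i)`
      (∀ (ρ : RepSpace p c) (Z : NormalizedPolygon p d E),
        Φ ⟦ρ⟧ = Z ↔ ∃ ρ' : RepSpace p c, ρ' ≈ ρ ∧ ∀ i, ρ'.1 (sGen p i) = Z.1 i) ∧
      -- non-abelian representations
      (∀ ρ : RepSpace p c, ¬ IsAbelianRep ρ.1 ↔ ∃ i, sideLength (Φ ⟦ρ⟧).1 i ∉ E) ∧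
      (c = -1 → ∀ (Z : NormalizedPolygon p d E) (i : Fin n), sideLength Z.1 i ≠ π) ∧
      -- reflection in the `⟨j, k⟩`-plane induces the involution `τ`
      (∀ (C : RepClass p c) (i : Fin n),
        ((Φ (τ C)).1 i : ℍ[ℝ]) = reflJK ((Φ C).1 i : ℍ[ℝ])) ∧
      Continuous τ ∧ Function.Involutive τ ∧
      -- arbitrary pretzel links
      (∀ ρ : RepSpace p c,
        IsMeridionallyDihedral ρ.1 ↔ ∀ i, ((Φ ⟦ρ⟧).1 i : ℍ[ℝ]).imI = 0) ∧
      (∀ ρ : RepSpace p c, τ ⟦ρ⟧ = ⟦ρ⟧ ↔ IsMeridionallyDihedral ρ.1) ∧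
      (∀ ρ : RepSpace p c, IsMeridionallyDihedral ρ.1 → IsBinaryDihedral ρ.1) ∧
      -- pretzel knots
      (IsPretzelKnot p →
        (∀ ρ : RepSpace p c,
          IsBinaryDihedral ρ.1 ↔ ∀ i, ((Φ ⟦ρ⟧).1 i : ℍ[ℝ]).imI = 0) ∧
        (∀ ρ : RepSpace p c, τ ⟦ρ⟧ = ⟦ρ⟧ ↔ IsBinaryDihedral ρ.1) ∧
        -- non-abelian classes that are not binary dihedral come in pairs
        (∀ ρ ρ' : RepSpace p c, ¬ IsAbelianRep ρ.1 → ¬ IsBinaryDihedral ρ.1 → τ ⟦ρ⟧ = ⟦ρ'⟧ →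
          ¬ IsAbelianRep ρ'.1 ∧ ¬ IsBinaryDihedral ρ'.1 ∧
            (⟦ρ'⟧ : RepClass p c) ≠ ⟦ρ⟧)) := by

  have h : IsSignCase c d E := hcase
  refine ⟨NormalizedPolygon.equivRepClass h, RepClass.twist,
    NormalizedPolygon.equivRepClass_eq_iff h, fun ρ => ?_, fun hc Z i => ?_, fun C i => ?_,
    RepClass.continuous_twist, RepClass.involutive_twist, isMeridionallyDihedral_iff h,
    twist_eq_self_iff_isMeridionallyDihedral h,
    fun ρ => IsMeridionallyDihedral.isBinaryDihedral, fun hK => ⟨fun ρ => ?_, fun ρ => ?_, ?_⟩⟩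
  · rw [isAbelianRep_iff h, not_forall]
  · exact IsSignCase.angle_ne_pi hc (Z.2.1 _) (Z.zpow_eq h i)
  · rw [NormalizedPolygon.equivRepClass_twist, NormalizedPolygon.reflect_coe]
  · rw [isBinaryDihedral_iff h hK, isMeridionallyDihedral_iff h]
  · rw [isBinaryDihedral_iff h hK, twist_eq_self_iff_isMeridionallyDihedral h]
  · intro ρ ρ' hab hbd hρ'
    rw [isBinaryDihedral_iff h hK, ← twist_eq_self_iff_isMeridionallyDihedral h] at hbd ⊢
    refine ⟨fun hab' => hab ?_, fun hfix => hbd ?_, fun heq => hbd (hρ'.trans heq)⟩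
    -- Sign change preserves commutativity and is an involution, so an abelian `ρ'` would make `ρ`
    -- abelian.
    · have := (hab'.of_equiv (Setoid.symm (Quotient.exact hρ'))).signTwist
      rwa [RepSpace.twist, signTwist_signTwist] at this
    · have := congrArg RepClass.twist hρ'
      rw [RepClass.involutive_twist, hfix, ← hρ'] at this
      exact this.symm
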